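/- **Setting.** Terms are ground terms over a many-sorted signature $\Sigma$. An *extended rewrite theory* $\mathcal R=(\Sigma,\Delta\cup B,R)$ consists of $\Sigma$, a set $\Delta$ of oriented equations and a set $R$ of rewrite rules (all of the form $\lambda\to\rho$, with $\lambda,\rho$ of the same sort, $\lambda$ not a variable and $\mathrm{Var}(\rho)\subseteq \mathrm{Var}(\lambda)$; they may be collapsing, i.e. $\rho$ a variable, and nonleft-linear), the associativity and commutativity axioms $B$ for some binary operators, and built-in operators with at least one argument, whose calls $op(u_1,\dots,u_m)$ evaluate to terms of the same sort in an arbitrary prescribed way. An *execution trace* $t_0\xrightarrow{r_1}t_1\to\cdots\xrightarrow{r_n}t_n$ is a finite sequence of steps, each of which is an application $C[\lambda\sigma]\to C[\rho\sigma]$ of a rule or equation $r:\lambda\to\rho$ of $R\cup\Delta$, an evaluation $C[op(u_1,\dots,u_m)]\to C[u']$ of a built-in call, or an equality $t=_Bu$ modulo $B$; $r_i$ names the rule, equation, built-in operator, or $B$. **Labeling.** Labels are finite sets of atomic labels; an initial labeling gives distinct fresh atomic labels to the symbol occurrences. A step $t\to s$ is labeled as follows. * *Step $C[\lambda\sigma]\to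 C[\rho\sigma]$ by a rule or equation.* The context $C$, the function symbols of $\lambda$, and each term $x\sigma$ ($x\in\mathrm{Var}(\lambda)$) have initial labelings with disjoint codomains; $C$ and the $x\sigma$ have the same labels in $t$ and $s$; each function symbol of $\rho$ gets the union $l_\lambda$ of the labels of $\lambda$. ($s_4$) If $\rho$ is a variable, $l_\lambda$ is added to the label of the root of the contractum. ($s_5$) For each variable $x$ occurring more than once in $\lambda$, all the labels of $x\sigma$ are added to the label of the root of the contractum. * *Built-in step* ($s_6$) $C[op(u_1,\dots,u_m)]\to C[u']$. The source has an initial labeling; all symbols of $u'$ get the union of all labels occurring in $u_1,\dots,u_m$; the symbols of $C$ keep their labels (or, alternatively, each of them gets the union of all labels of the source; the result holds for both conventions). * *Step $t=_Bs$.* An initial labeling of $t$ is propagated through a sequence of flattening steps followed by a sequence of unflattening steps leading from $t$ to $s$. Flattening replaces nested occurrences of an AC operator $f$ by one variadic $f$ (with reordered arguments) labeled by the union of their labels; unflattening replaces a variadic $f$ by nested binary occurrences of $f$ that all receive its label; all other symbols keep their labels. **Slicing.** For a labeled step $t\to s$, the origins of a position $w$ of $s$ are the positions $v$ of $t$ such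 that the label of $v$ is contained in the label of some position $p\le w$ of $s$. Given a slicing criterion, i.e. a set $\mathcal O$ of positions of $t_n$, let $P_n=\mathcal O$, and let $P_j$ be the set of all origins of the positions in $P_{j+1}$, with respect to a labeling of $t_j\to t_{j+1}$. The term slice $t_j^\bullet$ is obtained from $t_j$ by replacing with $\bullet$ every maximal subterm whose position is not a prefix of a position in $P_j$. The trace slice $\mathcal T^\bullet$ starts at $t_0^\bullet$ and consists of the steps $t_{k-1}^\bullet\xrightarrow{r_k}t_k^\bullet$ with $t_{k-1}^\bullet\ne t_k^\bullet$. A ground term $t'$ is a concretization of $t^\bullet$, written $t^\bullet\propto t'$, if $t'$ is an instance of the term obtained from $t^\bullet$ by replacing the occurrences of $\bullet$ by distinct fresh variables. **Theorem 2 (extended soundness).** Let $\mathcal R$ be an extended rewrite theory, $\mathcal T$ an execution trace in $\mathcal R$, and $\mathcal O$ a slicing criterion for $\mathcal T$. For all labelings of the steps of $\mathcal T$ as above, let $\mathcal T^\bullet: t_0^\bullet\xrightarrow{r_1}t_1^\bullet\to\cdots\xrightarrow{r_m}t_m^\bullet$ be the corresponding trace slice (renumbered after discarding steps). Then for every concretization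 $t_0'$ of $t_0^\bullet$ there are terms $t_1',\dots,t_m'$ such that $t_0'\xrightarrow{r_1}t_1'\to\cdots\xrightarrow{r_m}t_m'$ is an execution trace in $\mathcal R$ and $t_i^\bullet\propto t_i'$ for $i=1,\dots,m$. -/

import Mathlib

namespace TraceSlicing

/-! ### Terms, positions, substitutions, contexts -/

/-- Raw terms (finite ordered trees) over function symbols `F` and variables `V`.  The arity is
not part of the tree, since flattened associative-commutative symbols are variadic; the terms of a
signature are singled out by `Theory.HasSort`. -/
inductive Tm (F V : Type*) where
  | var : V → Tm F V
  | app : F → List (Tm F V) → Tm F V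

/-- Raw ground terms. -/
abbrev GTm (F : Type*) := Tm F Empty

/-- Positions: the arguments of a symbol are numbered `1, 2, …`. -/
abbrev Pos := List ℕ

namespace Tm

variable {F G V W : Type*}

/-- Renaming of the function symbols. -/
def map (g : F → G) : Tm F V → Tm G V
  | .var x => .var x
  | .app f ts => .app (g f) (ts.map fun t => map g t)

/-- The instance of a term under a substitution. -/
def subst (σ : V → Tm F W) : Tm F V → Tm F W
  | .var x => σ x
  | .app f ts => .app f (ts.map fun t => subst σ t)

/-- The occurrences of function symbols of a term, as a list in preorder. -/
def symbols : Tm F V → List F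
  | .var _ => []
  | .app f ts => f :: ts.flatMap fun t => symbols t

/-- The occurrences of variables of a term, as a list from left to right. -/
def vars : Tm F V → List V
  | .var x => [x]
  | .app _ ts => ts.flatMap fun t => vars t

/-- The term is a variable. -/
def IsVar : Tm F V → Prop
  | .var _ => True
  | .app _ _ => False

/-- The subterm at a position, if the position exists. -/
def subtermAt : Pos → Tm F V → Option (Tm F V)
  | [], t => some t
  | _ :: _, .var _ => none
  | 0 :: _, .app _ _ => none
  | (i + 1) :: p, .app _ ts => (ts[i]?).bind (subtermAt p)

/-- The set of positions of a term. -/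
def positions (t : Tm F V) : Set Pos := {p | (subtermAt p t).isSome}

end Tm

/-- Ground contexts with exactly one hole. -/
inductive Ctx (F : Type*) where
  | hole : Ctx F
  | app : F → List (GTm F) → Ctx F → List (GTm F) → Ctx F

namespace Ctx

variable {F G : Type*}

/-- Fill the hole. -/
def fill : Ctx F → GTm F → GTm F
  | .hole, t => t
  | .app f l C r, t => .app f (l ++ C.fill t :: r)

/-- The occurrences of function symbols of a context. -/
def symbols : Ctx F → List F
  | .hole => []
  | .app f l C r => f :: (l.flatMap Tm.symbols ++ C.symbols ++ r.flatMap Tm.symbols)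

/-- Renaming of the function symbols. -/
def map (g : F → G) : Ctx F → Ctx G
  | .hole => .hole
  | .app f l C r => .app (g f) (l.map (Tm.map g)) (C.map g) (r.map (Tm.map g))

end Ctx

/-! ### Extended rewrite theories -/

/-- A pair of terms, used as a rewrite rule or as an oriented equation. -/
structure Rule (F V : Type*) where
  lhs : Tm F V
  rhs : Tm F V

mutual

/-- The term is well sorted, of the given sort, for operators of rank `dom f → cod f` and
variables `x` of sort `vs x`. -/
def HasSort {S F V : Type*} (dom : F → List S) (cod : F → S) (vs : V → S) : Tm F V → S → Prop
  | .var x, s => vs x = s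
  | .app f ts, s => cod f = s ∧ HasSorts dom cod vs ts (dom f)

/-- The list of terms is well sorted, with the given list of sorts. -/
def HasSorts {S F V : Type*} (dom : F → List S) (cod : F → S) (vs : V → S) :
    List (Tm F V) → List S → Prop
  | [], [] => True
  | t :: ts, s :: ss => HasSort dom cod vs t s ∧ HasSorts dom cod vs ts ss
  | _, _ => False

end

/-- An extended rewrite theory `(Σ, Δ ∪ B, R)`: a many-sorted signature `Σ` (sorts `S`, operators
`F`, sorted variables `V`), oriented equations `Δ`, associativity and commutativity axioms `B` for
the operators in `ac`, rewrite rules `R`, and built-in operators.  Rules and equations may be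
collapsing and need not be left-linear. -/
structure Theory (S F V : Type*) where
  /-- argument sorts of an operator -/
  dom : F → List S
  /-- result sort of an operator -/
  cod : F → S
  /-- sort of a variable -/
  vsort : V → S
  /-- the associative-commutative operators -/
  ac : Set F
  ac_rank : ∀ f ∈ ac, dom f = [cod f, cod f]
  /-- the oriented equations `Δ` -/
  eqns : Set (Rule F V)
  /-- the rewrite rules `R` -/
  rules : Set (Rule F V)
  lhs_not_var : ∀ r ∈ rules ∪ eqns, ¬ r.lhs.IsVar
  vars_subset : ∀ r ∈ rules ∪ eqns, r.rhs.vars ⊆ r.lhs.vars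
  well_sorted : ∀ r ∈ rules ∪ eqns, ∃ s,
    HasSort dom cod vsort r.lhs s ∧ HasSort dom cod vsort r.rhs s
  /-- `builtin op args t`: the call `op(args)` of the built-in operator `op` evaluates to `t` -/
  builtin : F → List (GTm F) → GTm F → Prop
  builtin_args : ∀ op args t, builtin op args t → args ≠ []
  builtin_sorted : ∀ op args t, builtin op args t →
    HasSort dom cod Empty.elim (.app op args) (cod op) ∧ HasSort dom cod Empty.elim t (cod op)

/-- The ground terms of the signature. -/
def Theory.IsGround {S F V : Type*} (R : Theory S F V) (t : GTm F) : Prop :=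
  ∃ s, HasSort R.dom R.cod Empty.elim t s

/-- `t =_B u`: the least congruence containing the associativity and commutativity axioms of the
operators in `ac`. -/
inductive Theory.ACEq {S F V : Type*} (R : Theory S F V) : GTm F → GTm F → Prop
  | comm (f : F) (hf : f ∈ R.ac) (x y : GTm F) : ACEq R (.app f [x, y]) (.app f [y, x])
  | assoc (f : F) (hf : f ∈ R.ac) (x y z : GTm F) :
      ACEq R (.app f [x, .app f [y, z]]) (.app f [.app f [x, y], z])
  | refl (t : GTm F) : ACEq R t t
  | symm {t u : GTm F} : ACEq R t u → ACEq R u t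
  | trans {t u v : GTm F} : ACEq R t u → ACEq R u v → ACEq R t v
  | ctx (C : Ctx F) {t u : GTm F} : ACEq R t u → ACEq R (C.fill t) (C.fill u)

/-- What a step of an execution trace applies: a rule or oriented equation, the evaluation of a
built-in operator, or the axioms `B`. -/
inductive StepName (F V : Type*) where
  | rule : Rule F V → StepName F V
  | builtin : F → StepName F V
  | ac : StepName F V

/-- The steps of execution traces, on raw ground terms. -/
inductive Theory.RawStep {S F V : Type*} (R : Theory S F V) :
    StepName F V → GTm F → GTm F → Prop
  | rule (r : Rule F V) (hr : r ∈ R.rules ∪ R.eqns) (C : Ctx F) (σ : V → GTm F)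
      (hσ : ∀ x ∈ r.lhs.vars, HasSort R.dom R.cod Empty.elim (σ x) (R.vsort x)) :
      RawStep R (.rule r) (C.fill (r.lhs.subst σ)) (C.fill (r.rhs.subst σ))
  | builtin (C : Ctx F) (op : F) (args : List (GTm F)) (t : GTm F) (h : R.builtin op args t) :
      RawStep R (.builtin op) (C.fill (.app op args)) (C.fill t)
  | ac (t u : GTm F) (h : R.ACEq t u) : RawStep R .ac t u

/-- `t → u` by the named rule, equation, built-in operator or axioms, between ground terms of the
signature. -/
def Theory.Step {S F V : Type*} (R : Theory S F V) (n : StepName F V) (t u : GTm F) : Prop :=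
  R.IsGround t ∧ R.IsGround u ∧ R.RawStep n t u

/-- `R.IsTrace t₀ [(r₁, t₁), …, (rₙ, tₙ)]`: the sequence `t₀ →^{r₁} t₁ → … →^{rₙ} tₙ` is an
execution trace of `R`. -/
inductive Theory.IsTrace {S F V : Type*} (R : Theory S F V) :
    GTm F → List (StepName F V × GTm F) → Prop
  | nil (t : GTm F) (h : R.IsGround t) : IsTrace R t []
  | cons (n : StepName F V) (t u : GTm F) (T : List (StepName F V × GTm F))
      (h : R.Step n t u) (hT : IsTrace R u T) : IsTrace R t ((n, u) :: T)

/-- The last term of a trace. -/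
def lastTerm {F V : Type*} : GTm F → List (StepName F V × GTm F) → GTm F
  | t, [] => t
  | _, (_, u) :: T => lastTerm u T

/-! ### Labeled terms -/

/-- Labels: finite sets of atomic labels. -/
abbrev Label (A : Type*) := Finset A

/-- Labeled terms: every occurrence of a function symbol carries a label; variables do not. -/
abbrev LTm (F A V : Type*) := Tm (F × Label A) V

/-- Labeled ground terms. -/
abbrev LGTm (F A : Type*) := GTm (F × Label A)

section Labels

variable {F A V : Type*}

/-- The underlying term of a labeled term. -/
def erase (t : LTm F A V) : Tm F V := t.map Prod.fst

/-- The labels of the symbol occurrences of a labeled term. -/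
def labels (t : LTm F A V) : List (Label A) := t.symbols.map Prod.snd

/-- The labels of the symbol occurrences of a labeled context. -/
def ctxLabels (C : Ctx (F × Label A)) : List (Label A) := C.symbols.map Prod.snd

/-- Distinct atomic labels, one for each of the listed occurrences. -/
def IsInitial (ls : List (Label A)) : Prop := ls.Nodup ∧ ∀ l ∈ ls, ∃ a, l = {a}

/-- The label formed by joining all the listed labels. -/
def join [DecidableEq A] (ls : List (Label A)) : Label A := ls.foldr (· ∪ ·) ∅

/-- Attach the label `l` to every symbol occurrence. -/
def labelAll (l : Label A) (t : Tm F V) : LTm F A V := t.map fun f => (f, l)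

/-- Replace the label `l₀` of the root symbol by `l ∪ l₀`. -/
def addRootLabel [DecidableEq A] (l : Label A) : LGTm F A → LGTm F A
  | .var x => .var x
  | .app (f, l₀) ts => .app (f, l ∪ l₀) ts

/-- The label at a position, if the position exists. -/
def labelAt (p : Pos) (t : LGTm F A) : Option (Label A) :=
  match t.subtermAt p with
  | some (.app (_, l) _) => some l
  | _ => none

/-- The arguments obtained by removing all occurrences of `f` at the top of a term: the maximal
subterms not rooted by `f` such that all symbols above them are `f`. -/
def flatArgs [DecidableEq F] (f : F) : LGTm F A → List (LGTm F A)
  | .var x => [.var x]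
  | .app (g, l) ts => if g = f then ts.flatMap fun t => flatArgs f t else [.app (g, l) ts]

/-- The labels of the occurrences of `f` reachable from the root through occurrences of `f`. -/
def topLabels [DecidableEq F] (f : F) : LGTm F A → List (Label A)
  | .var _ => []
  | .app (g, l) ts => if g = f then l :: ts.flatMap fun t => topLabels f t else []

/-- `Nested f l us t`: the term `t` arises from the list `us` of terms not rooted by `f` by
combining them, in this order, with binary occurrences of `f`, all of them labeled by `l`. -/
inductive Nested (f : F) (l : Label A) : List (LGTm F A) → LGTm F A → Prop
  | leaf (g : F) (l' : Label A) (ts : List (LGTm F A)) (hg : g ≠ f) :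
      Nested f l [.app (g, l') ts] (.app (g, l') ts)
  | node (us vs : List (LGTm F A)) (t u : LGTm F A) (ht : Nested f l us t)
      (hu : Nested f l vs u) : Nested f l (us ++ vs) (.app (f, l) [t, u])

end Labels

/-! ### Labeling of steps -/

section StepLabeling

variable {S F V A : Type*} [DecidableEq F] [DecidableEq V] [DecidableEq A]

/-- The labeled contractum of a rule `r`, for the labeled left-hand side `lhs` and the labeled
substitution `σ`.  All symbols of the right-hand side get the join `lr` of the labels of the redex
pattern, and the terms introduced by `σ` keep their labels.  If `r` is collapsing, then `lr` is
added to the label of the root of the contractum.  Finally, for each variable `x` that occurs more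
than once in the left-hand side, all the labels of `σ x` are added to the label of the root of the
contractum. -/
noncomputable def labeledContractum (r : Rule F V) (lhs : LTm F A V) (σ : V → LGTm F A) :
    LGTm F A :=
  let lr := join (labels lhs)
  let c := (labelAll lr r.rhs).subst σ
  let c := open scoped Classical in if r.rhs.IsVar then addRootLabel lr c else c
  let repeated := r.lhs.vars.dedup.filter fun x => 2 ≤ r.lhs.vars.count x
  addRootLabel (join (repeated.flatMap fun x => labels (σ x))) c

/-- A flattening step for an associative-commutative symbol `f`: the nested occurrences of `f` are
replaced by one variadic occurrence, labeled by the join of their labels; all other symbols keep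
their labels.  The ordering by which the arguments are sorted is left arbitrary. -/
inductive Theory.FlatStep (R : Theory S F V) : LGTm F A → LGTm F A → Prop
  | mk (C : Ctx (F × Label A)) (f : F) (hf : f ∈ R.ac) (l : Label A) (ts us : List (LGTm F A))
      (hu : us.Perm (flatArgs f (.app (f, l) ts))) :
      FlatStep R (C.fill (.app (f, l) ts))
        (C.fill (.app (f, join (topLabels f (.app (f, l) ts))) us))

/-- An unflattening step for an associative-commutative symbol `f`: a variadic occurrence of `f`,
whose arguments are not rooted by `f`, is replaced by nested binary occurrences of `f`, all of them
with the label of the original one; all other symbols keep their labels. -/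
inductive Theory.UnflatStep (R : Theory S F V) : LGTm F A → LGTm F A → Prop
  | mk (C : Ctx (F × Label A)) (f : F) (hf : f ∈ R.ac) (l : Label A) (us vs : List (LGTm F A))
      (h2 : 2 ≤ us.length) (hp : vs.Perm us) (t : LGTm F A) (ht : Nested f l vs t) :
      UnflatStep R (C.fill (.app (f, l) us)) (C.fill t)

/-- `R.StepLabeling n t u`: the labeled terms `t` and `u` are the source and the target of a
labeled step with name `n`. -/
inductive Theory.StepLabeling (R : Theory S F V) : StepName F V → LGTm F A → LGTm F A → Prop
  /-- Application of a rule or oriented equation: context, redex pattern and the terms substituted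
  for the variables of the left-hand side have initial labelings with disjoint codomains. -/
  | rule (r : Rule F V) (hr : r ∈ R.rules ∪ R.eqns) (C : Ctx (F × Label A)) (lhs : LTm F A V)
      (hlhs : erase lhs = r.lhs) (σ : V → LGTm F A)
      (hinit : IsInitial
        (ctxLabels C ++ labels lhs ++ r.lhs.vars.dedup.flatMap fun x => labels (σ x))) :
      StepLabeling R (.rule r) (C.fill (lhs.subst σ)) (C.fill (labeledContractum r lhs σ))
  /-- Evaluation of a built-in operator: all symbols of the result get the join of all labels of
  the arguments; the symbols of the context keep their labels. -/
  | builtin (C : Ctx (F × Label A)) (op : F) (l : Label A) (args : List (LGTm F A)) (t : GTm F)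
      (h : R.builtin op (args.map erase) t)
      (hinit : IsInitial (labels (C.fill (.app (op, l) args)))) :
      StepLabeling R (.builtin op) (C.fill (.app (op, l) args))
        (C.fill (labelAll (join (args.flatMap labels)) t))
  /-- As before, with the other convention for the context, which is admitted as well: each symbol
  of the context gets the join of all the labels of the source term. -/
  | builtinAll (C : Ctx (F × Label A)) (op : F) (l : Label A) (args : List (LGTm F A)) (t : GTm F)
      (h : R.builtin op (args.map erase) t)
      (hinit : IsInitial (labels (C.fill (.app (op, l) args)))) :
      StepLabeling R (.builtin op) (C.fill (.app (op, l) args))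
        ((C.map fun x => (x.1, join (labels (C.fill (.app (op, l) args))))).fill
          (labelAll (join (args.flatMap labels)) t))
  /-- Equality modulo `B`: an initial labeling is propagated through a sequence of flattening steps
  followed by a sequence of unflattening steps. -/
  | ac (t s u : LGTm F A) (hinit : IsInitial (labels t))
      (hflat : Relation.ReflTransGen R.FlatStep t s)
      (hunflat : Relation.ReflTransGen R.UnflatStep s u) :
      StepLabeling R .ac t u

/-- `R.IsTraceLabeling t₀ T 𝓛`: the list `𝓛` consists of a labeling (labeled source, labeled
target) for each step of the trace `T` starting from `t₀`. -/
inductive Theory.IsTraceLabeling (R : Theory S F V) :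
    GTm F → List (StepName F V × GTm F) → List (LGTm F A × LGTm F A) → Prop
  | nil (t : GTm F) : IsTraceLabeling R t [] []
  | cons (n : StepName F V) (t u : GTm F) (T : List (StepName F V × GTm F))
      (tL uL : LGTm F A) (𝓛 : List (LGTm F A × LGTm F A))
      (ht : erase tL = t) (hu : erase uL = u) (h : R.StepLabeling n tL uL)
      (hT : IsTraceLabeling R u T 𝓛) :
      IsTraceLabeling R t ((n, u) :: T) ((tL, uL) :: 𝓛)

end StepLabeling

/-! ### Backward tracing and slicing -/

section Slicing

variable {F V A : Type*}

/-- The origin positions in `t` of a position `w` of `s`, for a labeled step `t → s`. -/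
def origins (t s : LGTm F A) (w : Pos) : Set Pos :=
  {v | ∃ p lv lp, p <+: w ∧ labelAt v t = some lv ∧ labelAt p s = some lp ∧ lv ⊆ lp}

/-- The first set `P₀` of the sequence `[P₀, …, Pₙ]` of relevant position sets of a labeled trace
with respect to the slicing criterion `O`; the set `Pⱼ` is the value at the suffix `𝓛.drop j`. -/
def relevant (O : Set Pos) : List (LGTm F A × LGTm F A) → Set Pos
  | [] => O
  | (t, s) :: 𝓛 => ⋃ p ∈ relevant O 𝓛, origins t s p

/-- Term slices: terms over the signature and the fresh symbol `•`, represented as a variable. -/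
abbrev TermSlice (F : Type*) := Tm F Unit

/-- The symbol `•`. -/
def bullet : TermSlice F := .var ()

open scoped Classical in
mutual

/-- The slice, with respect to `P`, of a term found at position `p`. -/
noncomputable def slRec (P : Set Pos) : Pos → GTm F → TermSlice F
  | p, .app f ts => if ∃ w, p ++ w ∈ P then .app f (slArgs P p 1 ts) else bullet
  | _, .var _ => bullet

/-- The slices of the arguments, numbered from `i` on, of a symbol found at position `p`. -/
noncomputable def slArgs (P : Set Pos) : Pos → ℕ → List (GTm F) → List (TermSlice F)
  | _, _, [] => []
  | p, i, t :: ts => slRec P (p ++ [i]) t :: slArgs P p (i + 1) ts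

end

/-- The term slice of `t` with respect to a set of positions. -/
noncomputable def slice (t : GTm F) (P : Set Pos) : TermSlice F := slRec P [] t

mutual

/-- Replace the occurrences of `•` by distinct variables, named by their positions. -/
def freshen : Pos → TermSlice F → Tm F Pos
  | p, .var _ => .var p
  | p, .app f ts => .app f (freshenArgs p 1 ts)

/-- The same for the arguments, numbered from `i` on, of a symbol at position `p`. -/
def freshenArgs : Pos → ℕ → List (TermSlice F) → List (Tm F Pos)
  | _, _, [] => []
  | p, i, t :: ts => freshen (p ++ [i]) t :: freshenArgs p (i + 1) ts

end

/-- The term `t` is a concretization of the term slice `s`: it is an instance of the term obtained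
by replacing the occurrences of `•` in `s` by distinct variables. -/
def Concretizes (s : TermSlice F) (t : GTm F) : Prop :=
  ∃ σ : Pos → GTm F, (freshen [] s).subst σ = t

open scoped Classical in
/-- The steps `(rₖ, tₖ•)` of the trace slice, for the slicing criterion `O` and labelings `𝓛` of
the steps; the steps with `tₖ₋₁• = tₖ•` are discarded. -/
noncomputable def traceSlice (O : Set Pos) :
    GTm F → List (StepName F V × GTm F) → List (LGTm F A × LGTm F A) →
      List (StepName F V × TermSlice F)
  | t, (n, u) :: T, L :: 𝓛 =>
      if slice t (relevant O (L :: 𝓛)) = slice u (relevant O 𝓛) then traceSlice O u T 𝓛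
      else (n, slice u (relevant O 𝓛)) :: traceSlice O u T 𝓛
  | _, _, _ => []

end Slicing

end TraceSlicing

open TraceSlicing

namespace TraceSlicing

open List

-- The theorem follows by induction on the trace from a statement about one labeled step `t → u` and
-- a set `P` of positions of `u` (`Theory.StepLabeling.sound`): either the two slices coincide, so
-- that the step is discarded, or every well-sorted instance of the slice of `t` admits a step of
-- the same name to an instance of the slice of `u`.
--
-- The link between labels and slices is the relation `Match`, taken relative to the set `Q` of
-- atoms that label symbols of `u` at or above positions of `P`. Source labels are singletons, so a
-- symbol of `t` with label inside `Q` sits at an origin and survives in the slice; hence an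
-- instance of the slice of `t` matches `t` (`match_relevantAtoms`). Conversely, every symbol kept
-- in the slice of `u` has its label inside `Q`, so whatever matches `u` is an instance of that
-- slice (`Match.instantiates_slice`). It remains to carry a match from `t` to `u`.
--
-- For rules and built-in calls whose context keeps its labels, two cases arise. If no position of
-- `P` lies at or below the hole, the origins of `P` have the same prefixes as `P` and the slices
-- coincide (`slice_fill_eq`). Otherwise the root of the contractum is relevant. For a rule its
-- label contains the labels of the whole redex pattern, so the pattern is present in the
-- concretization, and also all labels below repeated variables, so those subterms are unchanged and
-- nonlinear matching still succeeds (`Match.exists_subst`). For a built-in call its label contains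
-- all labels of the arguments, so the call itself is unchanged. If instead the context collects all
-- labels of the source, a nonempty `P` makes the whole source relevant.
--
-- For equality modulo `B` the intermediate terms are variadic. The match is carried through each
-- flattening and unflattening step, while the right-nested binary form (`Theory.binarize`) of the
-- concretization stays in one `B`-class; on well-sorted terms this form is the identity.

theorem forall₂_append_left {α β : Type*} {r : α → β → Prop} {l₁ l₂ : List α} {u : List β}
    (h : Forall₂ r (l₁ ++ l₂) u) :
    ∃ u₁ u₂, Forall₂ r l₁ u₁ ∧ Forall₂ r l₂ u₂ ∧ u = u₁ ++ u₂ := by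
  induction l₁ generalizing u with
  | nil => exact ⟨[], u, .nil, h, rfl⟩
  | cons a l₁ ih =>
    cases h with
    | cons h1 h2 =>
      obtain ⟨u₁, u₂, p, q, rfl⟩ := ih h2
      exact ⟨_ :: u₁, u₂, .cons h1 p, q, rfl⟩

/-! ### Terms, sorts and substitutions -/

namespace Tm

variable {F G H V W : Type*}

theorem induct {P : Tm F V → Prop} (hv : ∀ x, P (.var x))
    (ha : ∀ f ts, (∀ t ∈ ts, P t) → P (.app f ts)) : ∀ t, P t
  | .var x => hv x
  | .app f ts => ha f ts fun t _ => induct hv ha t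

theorem ground_induct {P : GTm F → Prop}
    (ha : ∀ f ts, (∀ t ∈ ts, P t) → P (.app f ts)) (t : GTm F) : P t :=
  induct (fun x => x.elim) ha t

theorem subst_congr {σ τ : V → Tm F W} (t : Tm F V) (h : ∀ x ∈ t.vars, σ x = τ x) :
    t.subst σ = t.subst τ := by
  induction t using induct with
  | hv x => simpa [vars, subst] using h
  | ha f ts ih =>
    simp only [subst, app.injEq, true_and]
    refine List.map_congr_left fun t ht => ih t ht fun x hx => h x ?_
    simp only [vars, List.mem_flatMap]
    exact ⟨t, ht, hx⟩

theorem vars_map (g : F → G) (t : Tm F V) : (t.map g).vars = t.vars := by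
  induction t using induct with
  | hv x => simp [map, vars]
  | ha f ts ih =>
    simp only [map, vars, List.flatMap_map]
    exact List.flatMap_congr ih

theorem map_map (g : F → G) (h : G → H) (t : Tm F V) : (t.map g).map h = t.map (h ∘ g) := by
  induction t using induct with
  | hv x => simp [map]
  | ha f ts ih =>
    simp only [map, List.map_map, app.injEq]
    exact ⟨rfl, List.map_congr_left ih⟩

theorem map_id (t : Tm F V) : t.map id = t := by
  induction t using induct with
  | hv x => simp [map]
  | ha f ts ih =>
    simp only [map, app.injEq]
    exact ⟨rfl, (List.map_congr_left ih).trans (List.map_id ts)⟩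

end Tm

section Sorts

variable {S F V : Type*} {dom : F → List S} {cod : F → S} {vs : V → S}

theorem hasSorts_iff {ts : List (Tm F V)} {ss : List S} :
    HasSorts dom cod vs ts ss ↔ Forall₂ (HasSort dom cod vs) ts ss := by
  induction ts generalizing ss with
  | nil => cases ss <;> simp [HasSorts]
  | cons t ts ih => cases ss <;> simp [HasSorts, ih]

theorem hasSort_app {f : F} {ts : List (Tm F V)} {s : S} :
    HasSort dom cod vs (.app f ts) s ↔
      cod f = s ∧ Forall₂ (HasSort dom cod vs) ts (dom f) := by
  simp [HasSort, hasSorts_iff]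

theorem HasSort.unique {t : GTm F} {s s' : S} (h : HasSort dom cod Empty.elim t s)
    (h' : HasSort dom cod Empty.elim t s') : s = s' := by
  cases t with
  | var x => exact x.elim
  | app f ts => exact (hasSort_app.1 h).1.symm.trans (hasSort_app.1 h').1

theorem hasSort_fill {C : Ctx F} {a b : GTm F}
    (h : ∀ s, HasSort dom cod Empty.elim a s → HasSort dom cod Empty.elim b s) {s : S}
    (hC : HasSort dom cod Empty.elim (C.fill a) s) :
    HasSort dom cod Empty.elim (C.fill b) s := by
  induction C generalizing s with
  | hole => exact h s hC
  | app f l C r ih =>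
    simp only [Ctx.fill, hasSort_app] at hC ⊢
    refine ⟨hC.1, ?_⟩
    obtain ⟨l₁, l₂, p, q, e⟩ := forall₂_append_left hC.2
    rw [e]
    refine List.rel_append p ?_
    cases q with
    | cons q1 q2 => exact .cons (ih q1) q2

theorem hasSort_of_fill {C : Ctx F} {a : GTm F} {s : S}
    (hC : HasSort dom cod Empty.elim (C.fill a) s) : ∃ s', HasSort dom cod Empty.elim a s' := by
  induction C generalizing s with
  | hole => exact ⟨s, hC⟩
  | app f l C r ih =>
    simp only [Ctx.fill, hasSort_app] at hC
    obtain ⟨l₁, l₂, p, q, e⟩ := forall₂_append_left hC.2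
    cases q with
    | cons q1 q2 => exact ih q1

/-- Recovers the sorting of a substitution from that of the instance; this makes the substitution
read off from a concretization admissible for a rewrite step. -/
theorem hasSort_of_subst {σ : V → GTm F} (p : Tm F V) {s : S} (hp : HasSort dom cod vs p s)
    (h : HasSort dom cod Empty.elim (p.subst σ) s) :
    ∀ x ∈ p.vars, HasSort dom cod Empty.elim (σ x) (vs x) := by
  induction p using Tm.induct generalizing s with
  | hv y =>
    simp only [HasSort, Tm.subst, Tm.vars, List.mem_singleton] at *
    rintro x rfl
    rwa [hp]
  | ha f ts ih =>
    simp only [Tm.subst, hasSort_app] at hp h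
    have h1 := hp.2
    have h2 := h.2
    intro x hx
    simp only [Tm.vars, List.mem_flatMap] at hx
    obtain ⟨t, ht, hx⟩ := hx
    clear hp h
    generalize dom f = ss at h1 h2
    induction h1 with
    | nil => simp at ht
    | cons a b ih' =>
      simp only [List.map_cons, List.forall₂_cons] at h2
      rcases List.mem_cons.1 ht with rfl | ht
      · exact ih _ (by simp) a h2.1 x hx
      · exact ih' (fun t ht => ih t (by simp [ht])) ht h2.2

theorem HasSort.subst {σ : V → GTm F} (p : Tm F V) {s : S} (hp : HasSort dom cod vs p s)
    (h : ∀ x ∈ p.vars, HasSort dom cod Empty.elim (σ x) (vs x)) :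
    HasSort dom cod Empty.elim (p.subst σ) s := by
  induction p using Tm.induct generalizing s with
  | hv y =>
    simp only [HasSort, Tm.subst, Tm.vars, List.mem_singleton] at *
    rw [← hp]
    exact h y rfl
  | ha f ts ih =>
    simp only [Tm.subst, hasSort_app] at hp ⊢
    refine ⟨hp.1, ?_⟩
    have h1 := hp.2
    clear hp
    simp only [Tm.vars, List.mem_flatMap] at h
    generalize dom f = ss at h1
    induction h1 with
    | nil => simp
    | cons a b ih' =>
      refine .cons (ih _ (by simp) a fun x hx => h x ⟨_, by simp, hx⟩)
        (ih' (fun t ht => ih t (by simp [ht])) ?_)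
      rintro x ⟨t, ht, hx⟩
      exact h x ⟨t, by simp [ht], hx⟩

end Sorts

/-! ### Labels and positions -/

section Labels

variable {F A V : Type*}

@[simp] theorem erase_app (f : F) (l : Label A) (ts : List (LTm F A V)) :
    erase (.app (f, l) ts) = .app f (ts.map erase) := by
  simp only [erase, Tm.map]; rfl

theorem erase_labelAll (l : Label A) (t : Tm F V) : erase (labelAll l t) = t := by
  rw [erase, labelAll, Tm.map_map]
  exact Tm.map_id t

theorem erase_fill (C : Ctx (F × Label A)) (a : LGTm F A) :
    erase (C.fill a) = (C.map Prod.fst).fill (erase a) := by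
  induction C with
  | hole => rfl
  | app f l C r ih =>
    obtain ⟨f, l₀⟩ := f
    simp [Ctx.fill, Ctx.map, ih]
    rfl

theorem ctx_map_map {F G H : Type*} (g : F → G) (h : G → H) (C : Ctx F) :
    (C.map g).map h = C.map (h ∘ g) := by
  induction C with
  | hole => rfl
  | app f l C r ih => simp [Ctx.map, ih, Function.comp_def, Tm.map_map]

theorem labels_app (f : F) (l : Label A) (ts : List (LTm F A V)) :
    labels (.app (f, l) ts) = l :: ts.flatMap labels := by
  simp only [labels, Tm.symbols, List.map_cons, List.map_flatMap]
  rfl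

@[simp] theorem labelAt_nil (f : F) (l : Label A) (ts : List (LGTm F A)) :
    labelAt [] (.app (f, l) ts) = some l := rfl

@[simp] theorem labelAt_zero (q : Pos) (t : LGTm F A) : labelAt (0 :: q) t = none := by
  cases t <;> simp [labelAt, Tm.subtermAt]

@[simp] theorem labelAt_succ (i : ℕ) (q : Pos) (f : F × Label A) (ts : List (LGTm F A)) :
    labelAt ((i + 1) :: q) (.app f ts) = (ts[i]?).bind (labelAt q) := by
  simp only [labelAt, Tm.subtermAt]
  cases ts[i]? <;> rfl

theorem exists_labelAt_nil (t : LGTm F A) : ∃ l, labelAt [] t = some l := by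
  cases t with
  | var x => exact x.elim
  | app f ts => exact ⟨f.2, rfl⟩

theorem mem_labels_of_labelAt {t : LGTm F A} {q : Pos} {l : Label A}
    (h : labelAt q t = some l) : l ∈ labels t := by
  induction t using Tm.ground_induct generalizing q with
  | ha f ts ih =>
    obtain ⟨f, l₀⟩ := f
    rw [labels_app]
    match q with
    | [] => simp_all
    | 0 :: q => simp at h
    | (i + 1) :: q =>
      simp only [labelAt_succ, Option.bind_eq_some_iff] at h
      obtain ⟨t, ht, h⟩ := h
      have := List.mem_of_getElem? ht
      exact List.mem_cons_of_mem _ (List.mem_flatMap.2 ⟨t, this, ih t this h⟩)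

/-- If the indices differed, `b` would be counted once in each of the two blocks. -/
theorem count_flatMap_of_ne {α β : Type*} [DecidableEq β] {g : α → List β} {b : β} {ts : List α}
    {i j : ℕ} {x y : α} (hi : ts[i]? = some x) (hj : ts[j]? = some y) (hx : b ∈ g x)
    (hy : b ∈ g y) (h : (ts.flatMap g).count b ≤ 1) : i = j := by
  induction ts generalizing i j with
  | nil => simp at hi
  | cons t ts ih =>
    rw [List.flatMap_cons, List.count_append] at h
    have key : ∀ k z, ts[k]? = some z → b ∈ g z → 1 ≤ (ts.flatMap g).count b := fun k z hk hz =>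
      List.count_pos_iff.2 (List.mem_flatMap.2 ⟨z, List.mem_of_getElem? hk, hz⟩)
    cases i <;> cases j <;>
      simp only [List.getElem?_cons_zero, List.getElem?_cons_succ, Option.some.injEq] at hi hj
    · rfl
    · subst hi
      have := key _ _ hj hy
      have := List.count_pos_iff.2 hx
      omega
    · subst hj
      have := key _ _ hi hx
      have := List.count_pos_iff.2 hy
      omega
    · rw [ih hi hj (by omega)]

theorem count_le_flatMap {α β : Type*} [DecidableEq β] {g : α → List β} (b : β) {ts : List α}
    {x : α} (hx : x ∈ ts) : (g x).count b ≤ (ts.flatMap g).count b := by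
  induction ts with
  | nil => simp at hx
  | cons t ts ih =>
    rw [List.flatMap_cons, List.count_append]
    rcases List.mem_cons.1 hx with rfl | hx
    · omega
    · have := ih hx; omega

/-- A label that occurs at most once in a term determines its position. -/
theorem labelAt_inj [DecidableEq A] {t : LGTm F A} {p q : Pos} {l : Label A}
    (hl : (labels t).count l ≤ 1) (hp : labelAt p t = some l) (hq : labelAt q t = some l) :
    p = q := by
  induction t using Tm.ground_induct generalizing p q with
  | ha f ts ih =>
    obtain ⟨f, l₀⟩ := f
    rw [labels_app, List.count_cons] at hl
    have key : ∀ i q, labelAt ((i + 1) :: q) (.app (f, l₀) ts) = some l →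
        1 ≤ (ts.flatMap labels).count l := fun i q h => by
      simp only [labelAt_succ, Option.bind_eq_some_iff] at h
      obtain ⟨t, ht, h⟩ := h
      exact List.count_pos_iff.2
        (List.mem_flatMap.2 ⟨t, List.mem_of_getElem? ht, mem_labels_of_labelAt h⟩)
    match p, q with
    | [], [] => rfl
    | 0 :: p, _ => simp at hp
    | _, 0 :: q => simp at hq
    | [], (i + 1) :: q =>
      have := key _ _ hq
      simp only [labelAt_nil, Option.some.injEq] at hp
      simp [hp] at hl
      omega
    | (i + 1) :: p, [] =>
      have := key _ _ hp
      simp only [labelAt_nil, Option.some.injEq] at hq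
      simp [hq] at hl
      omega
    | (i + 1) :: p, (j + 1) :: q =>
      simp only [labelAt_succ, Option.bind_eq_some_iff] at hp hq
      obtain ⟨t, ht, hp⟩ := hp
      obtain ⟨u, hu, hq⟩ := hq
      obtain rfl : i = j := count_flatMap_of_ne ht hu (mem_labels_of_labelAt hp)
        (mem_labels_of_labelAt hq) (by omega)
      obtain rfl : t = u := by simpa [ht] using hu
      have hm := List.mem_of_getElem? ht
      rw [ih t hm ((count_le_flatMap l hm).trans (by omega)) hp hq]

theorem mem_join [DecidableEq A] {ls : List (Label A)} {a : A} :
    a ∈ join ls ↔ ∃ l ∈ ls, a ∈ l := by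
  induction ls with
  | nil => simp [join]
  | cons l ls ih => rw [join, List.foldr_cons, ← join, Finset.mem_union, ih]; simp

theorem subset_of_join_subset [DecidableEq A] {ls : List (Label A)} {Q : Set A}
    (h : (↑(join ls) : Set A) ⊆ Q) {l : Label A} (hl : l ∈ ls) : (↑l : Set A) ⊆ Q :=
  fun _ ha => h (mem_join.2 ⟨l, hl, ha⟩)

end Labels

-- Labels at and around the hole of a context

namespace Ctx

variable {F A : Type*}

/-- The position of the hole. -/
def pos : Ctx F → Pos
  | .hole => []
  | .app _ l C _ => (l.length + 1) :: C.pos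

theorem labelAt_fill (C : Ctx (F × Label A)) (a : LGTm F A) (q : Pos) :
    labelAt (C.pos ++ q) (C.fill a) = labelAt q a := by
  induction C with
  | hole => rfl
  | app f l C r ih => simp [pos, fill, ih]

theorem labelAt_fill_congr (C : Ctx (F × Label A)) (a b : LGTm F A) {q : Pos}
    (h : ¬ C.pos <+: q) : labelAt q (C.fill a) = labelAt q (C.fill b) := by
  induction C generalizing q with
  | hole => simp [pos] at h
  | app f l C r ih =>
    obtain ⟨f, l₀⟩ := f
    match q with
    | [] => simp [fill]
    | 0 :: q => simp
    | (i + 1) :: q =>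
      simp only [fill, labelAt_succ]
      by_cases hi : i = l.length
      · subst hi
        simp only [List.getElem?_append_right le_rfl, Nat.sub_self, List.getElem?_cons_zero,
          Option.bind_some]
        exact ih (by simpa [pos, List.cons_prefix_cons] using h)
      · congr 1
        rcases lt_or_gt_of_ne hi with hi | hi
        · simp [List.getElem?_append_left hi]
        · rw [List.getElem?_append_right hi.le, List.getElem?_append_right hi.le]
          obtain ⟨k, hk⟩ : ∃ k, i - l.length = k + 1 := ⟨i - l.length - 1, by omega⟩
          simp [hk]

/-- Only a permutation, because preorder puts the labels of the filling between those of the left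
and right parts of the context. -/
theorem labels_fill_perm (C : Ctx (F × Label A)) (a : LGTm F A) :
    (labels (C.fill a)).Perm (ctxLabels C ++ labels a) := by
  induction C with
  | hole => simp [fill, ctxLabels, symbols]
  | app f l C r ih =>
    obtain ⟨f, l₀⟩ := f
    have e : ∀ ts : List (LGTm F A), (ts.flatMap Tm.symbols).map Prod.snd = ts.flatMap labels :=
      fun ts => by simp only [List.map_flatMap]; rfl
    simp only [fill, labels_app, ctxLabels, symbols, List.map_cons, List.map_append, e,
      List.flatMap_append, List.flatMap_cons, List.cons_append, List.append_assoc]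
    refine .cons _ (.append_left _ ?_)
    rw [ctxLabels] at ih
    refine (ih.append_right _).trans ?_
    rw [List.append_assoc]
    exact .append_left _ List.perm_append_comm

theorem mem_ctxLabels_of_labelAt {C : Ctx (F × Label A)} {a : LGTm F A} {q : Pos} {l : Label A}
    (h : ¬ C.pos <+: q) (hq : labelAt q (C.fill a) = some l) : l ∈ ctxLabels C := by
  induction C generalizing q with
  | hole => simp [pos] at h
  | app f ls C r ih =>
    obtain ⟨f, l₀⟩ := f
    have e : ∀ ts : List (LGTm F A), (ts.flatMap Tm.symbols).map Prod.snd = ts.flatMap labels :=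
      fun ts => by simp only [List.map_flatMap]; rfl
    simp only [ctxLabels, symbols, List.map_cons, List.map_append, e, List.mem_cons,
      List.mem_append]
    match q with
    | [] => simp [fill] at hq; simp [hq]
    | 0 :: q => simp at hq
    | (i + 1) :: q =>
      simp only [fill, labelAt_succ, Option.bind_eq_some_iff] at hq
      obtain ⟨t, ht, hq⟩ := hq
      rcases lt_trichotomy i ls.length with hi | hi | hi
      · rw [List.getElem?_append_left hi] at ht
        exact .inr (.inl (.inl
          (List.mem_flatMap.2 ⟨t, List.mem_of_getElem? ht, mem_labels_of_labelAt hq⟩)))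
      · subst hi
        simp only [List.getElem?_append_right le_rfl, Nat.sub_self, List.getElem?_cons_zero,
          Option.some.injEq] at ht
        subst ht
        exact .inr (.inl (.inr (ih (by simpa [pos, List.cons_prefix_cons] using h) hq)))
      · rw [List.getElem?_append_right hi.le] at ht
        obtain ⟨k, hk⟩ : ∃ k, i - ls.length = k + 1 := ⟨i - ls.length - 1, by omega⟩
        rw [hk, List.getElem?_cons_succ] at ht
        exact .inr (.inr
          (List.mem_flatMap.2 ⟨t, List.mem_of_getElem? ht, mem_labels_of_labelAt hq⟩))

end Ctx

theorem forall₂_iff_getElem? {α β : Type*} {r : α → β → Prop} {as : List α} {bs : List β} :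
    Forall₂ r as bs ↔ as.length = bs.length ∧
      ∀ (i : ℕ) (a : α) (b : β), as[i]? = some a → bs[i]? = some b → r a b := by
  induction as generalizing bs with
  | nil => cases bs <;> simp
  | cons x as ih =>
    cases bs with
    | nil => simp
    | cons y bs =>
      simp only [forall₂_cons, ih, List.length_cons, Nat.add_right_cancel_iff]
      constructor
      · rintro ⟨h, h1, h2⟩
        refine ⟨h1, fun i a b ha hb => ?_⟩
        cases i with
        | zero => simp_all
        | succ i => exact h2 i a b (by simpa using ha) (by simpa using hb)
      · rintro ⟨h1, h2⟩
        exact ⟨h2 0 x y rfl rfl, h1, fun i a b ha hb =>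
          h2 (i + 1) a b (by simpa using ha) (by simpa using hb)⟩

/-! ### Concretizations as a relation -/

section Slices

variable {F A : Type*}

/-- The ground term is obtained from the slice by replacing the occurrences of `•`. -/
inductive Instantiates : TermSlice F → GTm F → Prop
  | bullet (t : GTm F) : Instantiates (.var ()) t
  | app (f : F) (ss : List (TermSlice F)) (ts : List (GTm F)) (h : Forall₂ Instantiates ss ts) :
      Instantiates (.app f ss) (.app f ts)

theorem freshenArgs_getElem? (p : Pos) (ss : List (TermSlice F)) (i j : ℕ) :
    (freshenArgs p i ss)[j]? = ss[j]?.map (freshen (p ++ [i + j])) := by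
  induction ss generalizing i j with
  | nil => simp [freshenArgs]
  | cons s ss ih =>
    cases j with
    | zero => simp [freshenArgs]
    | succ j => simp [freshenArgs, ih, Nat.add_assoc, Nat.add_comm 1]

theorem length_freshenArgs (p : Pos) (ss : List (TermSlice F)) (i : ℕ) :
    (freshenArgs p i ss).length = ss.length := by
  induction ss generalizing i with
  | nil => rfl
  | cons s ss ih => simp [freshenArgs, ih]

theorem instantiates_subst (s : TermSlice F) (p : Pos) (σ : Pos → GTm F) :
    Instantiates s ((freshen p s).subst σ) := by
  induction s using Tm.induct generalizing p with
  | hv x => exact .bullet _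
  | ha f ss ih =>
    rw [freshen, Tm.subst]
    refine .app f ss _ (forall₂_iff_getElem?.2 ⟨by simp [length_freshenArgs], ?_⟩)
    intro i a b ha hb
    simp only [List.getElem?_map, freshenArgs_getElem?, ha, Option.map_some,
      Option.some.injEq] at hb
    subst hb
    exact ih a (List.mem_of_getElem? ha) _

/-- Since each `•` is named by its own position, sending a position to the subterm found there is
consistent, whatever the term is. -/
theorem Instantiates.subst_eq {s : TermSlice F} {t : GTm F} (h : Instantiates s t) {p : Pos}
    {σ : Pos → GTm F} (hσ : ∀ q u, t.subtermAt q = some u → σ (p ++ q) = u) :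
    (freshen p s).subst σ = t := by
  induction s using Tm.induct generalizing p t with
  | hv x => simpa [freshen, Tm.subst, Tm.subtermAt] using hσ [] t
  | ha f ss ih =>
    cases h with
    | app f _ ts h =>
      obtain ⟨hlen, h⟩ := forall₂_iff_getElem?.1 h
      simp only [freshen, Tm.subst, Tm.app.injEq, true_and]
      refine List.ext_getElem? fun i => ?_
      rw [List.getElem?_map, freshenArgs_getElem?]
      rcases lt_or_ge i ss.length with hi | hi
      · have h1 := List.getElem?_eq_getElem hi
        have h2 := List.getElem?_eq_getElem (hlen ▸ hi)
        rw [h1, h2]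
        simp only [Option.map_some, Option.some.injEq]
        refine ih _ (by simp) (h i _ _ h1 h2) fun q u hq => ?_
        rw [List.append_assoc, List.singleton_append, Nat.add_comm]
        exact hσ ((i + 1) :: q) u (by simpa [Tm.subtermAt, h2] using hq)
      · simp [List.getElem?_eq_none hi, List.getElem?_eq_none (hlen ▸ hi)]

/-- Trades the substitution on fresh variables for a structural relation that supports induction. -/
theorem concretizes_iff {s : TermSlice F} {t : GTm F} : Concretizes s t ↔ Instantiates s t := by
  constructor
  · rintro ⟨σ, rfl⟩
    exact instantiates_subst s [] σ
  · intro h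
    -- The default `t` is a dummy: only positions that exist in `t` are ever looked up.
    exact ⟨fun q => (t.subtermAt q).getD t, h.subst_eq fun q u hq => by simp [hq]⟩

-- Slices as functions of the set of relevant prefixes

theorem slArgs_getElem? (P : Set Pos) (p : Pos) (ts : List (GTm F)) (i j : ℕ) :
    (slArgs P p i ts)[j]? = ts[j]?.map (slRec P (p ++ [i + j])) := by
  induction ts generalizing i j with
  | nil => simp [slArgs]
  | cons s ss ih =>
    cases j with
    | zero => simp [slArgs]
    | succ j => simp [slArgs, ih, Nat.add_assoc, Nat.add_comm 1]

theorem length_slArgs (P : Set Pos) (p : Pos) (ts : List (GTm F)) (i : ℕ) :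
    (slArgs P p i ts).length = ts.length := by
  induction ts generalizing i with
  | nil => simp [slArgs]
  | cons s ss ih => simp [slArgs, ih]

theorem slRec_of_mem {P : Set Pos} {p : Pos} {f : F} {ts : List (GTm F)}
    (h : ∃ w, p ++ w ∈ P) : slRec P p (.app f ts) = .app f (slArgs P p 1 ts) := by
  rw [slRec, if_pos h]

theorem slRec_of_not_mem {P : Set Pos} {p : Pos} {t : GTm F} (h : ¬ ∃ w, p ++ w ∈ P) :
    slRec P p t = bullet := by
  cases t with
  | var x => exact x.elim
  | app f ts => rw [slRec, if_neg h]

/-- A slice sees `P` only through which positions of the term are prefixes of elements of `P`. -/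
theorem slRec_congr {P P' : Set Pos} {p : Pos} (t : LGTm F A)
    (h : ∀ q l, labelAt q t = some l → ((∃ w, p ++ q ++ w ∈ P) ↔ ∃ w, p ++ q ++ w ∈ P')) :
    slRec P p (erase t) = slRec P' p (erase t) := by
  induction t using Tm.ground_induct generalizing p with
  | ha f ts ih =>
    obtain ⟨f, l⟩ := f
    have h0 := h [] l rfl
    simp only [List.append_nil] at h0
    by_cases hP : ∃ w, p ++ w ∈ P
    · rw [erase_app, slRec_of_mem hP, slRec_of_mem (h0.1 hP)]
      congr 1
      refine List.ext_getElem? fun i => ?_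
      simp only [slArgs_getElem?, List.getElem?_map, Option.map_map]
      rcases ht : ts[i]? with _ | t
      · rfl
      · simp only [Option.map_some, Function.comp_apply, Option.some.injEq]
        refine ih t (List.mem_of_getElem? ht) fun q l hq => ?_
        have := h ((i + 1) :: q) l (by simp [ht, hq])
        rw [Nat.add_comm 1]
        simpa using this
    · rw [slRec_of_not_mem hP, slRec_of_not_mem (fun h => hP (h0.2 h))]

/-- When the hole itself is sliced away, the fillings are invisible, so only prefixes among the
positions of the context matter. -/
theorem slRec_fill_congr {P P' : Set Pos} {p : Pos} (C : Ctx (F × Label A)) (a b : LGTm F A)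
    (h : ∀ q l, ¬ C.pos <+: q → labelAt q (C.fill a) = some l →
      ((∃ w, p ++ q ++ w ∈ P) ↔ ∃ w, p ++ q ++ w ∈ P'))
    (hP : ¬ ∃ w, p ++ C.pos ++ w ∈ P) (hP' : ¬ ∃ w, p ++ C.pos ++ w ∈ P') :
    slRec P p (erase (C.fill a)) = slRec P' p (erase (C.fill b)) := by
  induction C generalizing p with
  | hole =>
    simp only [Ctx.pos, List.append_nil] at hP hP'
    rw [slRec_of_not_mem hP, slRec_of_not_mem hP']
  | app f l C r ih =>
    obtain ⟨f, l₀⟩ := f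
    have h0 := h [] l₀ (by simp [Ctx.pos]) rfl
    simp only [List.append_nil] at h0
    simp only [Ctx.fill, erase_app]
    by_cases hm : ∃ w, p ++ w ∈ P
    · rw [slRec_of_mem hm, slRec_of_mem (h0.1 hm)]
      congr 1
      refine List.ext_getElem? fun i => ?_
      simp only [slArgs_getElem?, List.getElem?_map, Option.map_map]
      by_cases hi : i = l.length
      · subst hi
        simp only [List.getElem?_append_right le_rfl, Nat.sub_self, List.getElem?_cons_zero,
          Option.map_some, Function.comp_apply, Option.some.injEq]
        rw [Nat.add_comm 1]
        refine ih (fun q l' hq hl => ?_) (by simpa [Ctx.pos] using hP)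
          (by simpa [Ctx.pos] using hP')
        have := h ((l.length + 1) :: q) l' (by simpa [Ctx.pos, List.cons_prefix_cons] using hq)
          (by simpa [Ctx.fill] using hl)
        simpa using this
      · have e : ∀ c : LGTm F A, (l ++ c :: r)[i]? = (l ++ a :: r)[i]? := by
          intro c
          rcases lt_or_gt_of_ne hi with hi | hi
          · simp [List.getElem?_append_left hi]
          · rw [List.getElem?_append_right hi.le, List.getElem?_append_right hi.le]
            obtain ⟨k, hk⟩ : ∃ k, i - l.length = k + 1 := ⟨i - l.length - 1, by omega⟩
            simp [hk]
        rw [e, e (C.fill b)]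
        rcases ht : (l ++ a :: r)[i]? with _ | t
        · rfl
        · simp only [Option.map_some, Function.comp_apply, Option.some.injEq]
          refine slRec_congr t fun q l' hq => ?_
          have := h ((i + 1) :: q) l' (by simp [Ctx.pos, List.cons_prefix_cons, Ne.symm hi])
            (by simp [Ctx.fill, e, ht, hq])
          rw [Nat.add_comm 1]
          simpa using this
    · rw [slRec_of_not_mem hm, slRec_of_not_mem (fun h => hm (h0.2 h))]

end Slices

/-! ### Matching a labeled term up to irrelevant symbols -/

section Match

variable {F V A : Type*}

/-- The ground term agrees with the labeled term, except below occurrences of symbols whose label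
is not contained in `Q`.  The symbols of `E` are required to have arguments. -/
inductive Match (E : Set F) (Q : Set A) : LGTm F A → GTm F → Prop
  | cut (f : F) (l : Label A) (ts : List (LGTm F A)) (t' : GTm F) (h : ¬ (↑l : Set A) ⊆ Q) :
      Match E Q (.app (f, l) ts) t'
  | keep (f : F) (l : Label A) (ts : List (LGTm F A)) (ts' : List (GTm F))
      (hE : f ∈ E → ts ≠ []) (h : Forall₂ (Match E Q) ts ts') :
      Match E Q (.app (f, l) ts) (.app f ts')

variable {E : Set F} {Q : Set A}

theorem Match.inv {f : F} {l : Label A} {ts : List (LGTm F A)} {t' : GTm F}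
    (h : Match E Q (.app (f, l) ts) t') (hl : (↑l : Set A) ⊆ Q) :
    ∃ ts', t' = .app f ts' ∧ (f ∈ E → ts ≠ []) ∧ Forall₂ (Match E Q) ts ts' := by
  cases h with
  | cut _ _ _ _ h => exact absurd hl h
  | keep _ _ _ ts' hE h => exact ⟨ts', rfl, hE, h⟩

theorem match_erase (t : LGTm F A) : Match ∅ Q t (erase t) := by
  induction t using Tm.ground_induct with
  | ha f ts ih =>
    obtain ⟨f, l⟩ := f
    rw [erase_app]
    refine .keep f l ts _ (by simp) (forall₂_map_right_iff.2 (forall₂_same.2 ih))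

theorem Match.eq_erase {t : LGTm F A} {t' : GTm F} (h : Match E Q t t')
    (hl : ∀ l ∈ labels t, (↑l : Set A) ⊆ Q) : t' = erase t := by
  induction t using Tm.ground_induct generalizing t' with
  | ha f ts ih =>
    obtain ⟨f, l⟩ := f
    simp only [labels_app, List.mem_cons, List.mem_flatMap, forall_eq_or_imp] at hl
    obtain ⟨ts', rfl, -, hts⟩ := h.inv hl.1
    clear h
    rw [erase_app]
    congr 1
    have : Forall₂ (fun a b => b = erase a) ts ts' := by
      refine forall₂_iff_getElem?.2 ⟨hts.length_eq, fun i a b ha hb => ?_⟩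
      have hm := List.mem_of_getElem? ha
      exact ih a hm ((forall₂_iff_getElem?.1 hts).2 i a b ha hb) fun l hl' => hl.2 l ⟨a, hm, hl'⟩
    clear hts ih hl
    induction this with
    | nil => rfl
    | cons hb _ ih => rw [List.map_cons, hb, ih]

/-- Enlarging a label only makes it easier for the symbol to be irrelevant, so matching becomes
weaker. -/
theorem Match.addRootLabel [DecidableEq A] {t : LGTm F A} {t' : GTm F} (h : Match E Q t t')
    (l : Label A) : Match E Q (addRootLabel l t) t' := by
  cases h with
  | cut f l₀ ts _ h =>
    exact .cut f _ ts _ fun h' => h ((Finset.coe_subset.2 Finset.subset_union_right).trans h')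
  | keep f l₀ ts ts' hE h => exact .keep f _ ts ts' hE h

/-- The hypothesis asks a relevant symbol to lie above an element of `P`, not in `P`. Built-in steps
need this slack, since the operator symbol need not be an origin. -/
theorem match_of_instantiates {P : Set Pos} {p : Pos} {t : LGTm F A} {t' : GTm F}
    (h : ∀ q l, labelAt q t = some l → (↑l : Set A) ⊆ Q → ∃ w, p ++ q ++ w ∈ P)
    (ht : Instantiates (slRec P p (erase t)) t') : Match ∅ Q t t' := by
  induction t using Tm.ground_induct generalizing p t' with
  | ha f ts ih =>
    obtain ⟨f, l⟩ := f
    by_cases hl : (↑l : Set A) ⊆ Q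
    · have h0 := h [] l rfl hl
      rw [List.append_nil] at h0
      rw [erase_app, slRec_of_mem h0] at ht
      cases ht with
      | app _ _ ts' ht =>
        obtain ⟨hlen, ht⟩ := forall₂_iff_getElem?.1 ht
        refine .keep f l ts ts' (by simp)
          (forall₂_iff_getElem?.2 ⟨by simpa [length_slArgs] using hlen, fun i a b ha hb => ?_⟩)
        refine ih a (List.mem_of_getElem? ha) (p := p ++ [1 + i]) (fun q l hq hl => ?_)
          (ht i _ b (by simp [slArgs_getElem?, ha]) hb)
        have := h ((i + 1) :: q) l (by simp [ha, hq]) hl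
        rw [Nat.add_comm 1]
        simpa using this
    · exact .cut f l ts t' hl

theorem Match.instantiates {P : Set Pos} {p : Pos} {t : LGTm F A} {t' : GTm F}
    (h : ∀ q l, labelAt q t = some l → (∃ w, p ++ q ++ w ∈ P) → (↑l : Set A) ⊆ Q)
    (ht : Match E Q t t') : Instantiates (slRec P p (erase t)) t' := by
  induction t using Tm.ground_induct generalizing p t' with
  | ha f ts ih =>
    obtain ⟨f, l⟩ := f
    by_cases h0 : ∃ w, p ++ w ∈ P
    · obtain ⟨ts', rfl, -, ht⟩ := ht.inv (h [] l rfl (by simpa using h0))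
      rw [erase_app, slRec_of_mem h0]
      obtain ⟨hlen, ht⟩ := forall₂_iff_getElem?.1 ht
      refine .app f _ _ (forall₂_iff_getElem?.2 ⟨by simpa [length_slArgs] using hlen,
        fun i a b ha hb => ?_⟩)
      simp only [slArgs_getElem?, List.getElem?_map, Option.map_map, Option.map_eq_some_iff] at ha
      obtain ⟨a, ha, rfl⟩ := ha
      refine ih a (List.mem_of_getElem? ha) (fun q l hq hw => ?_) (ht i a b ha hb)
      refine h ((i + 1) :: q) l (by simp [ha, hq]) ?_
      rw [Nat.add_comm 1] at hw
      simpa using hw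
    · rw [slRec_of_not_mem h0]
      exact .bullet _

/-- Matching a context all of whose symbols above the hole are relevant. -/
theorem Match.of_fill {C : Ctx (F × Label A)} {a b : LGTm F A} {t' : GTm F}
    (hC : ∀ p l, p <+: C.pos → labelAt p (C.fill b) = some l → (↑l : Set A) ⊆ Q)
    (h : Match E Q (C.fill a) t') :
    ∃ (C' : Ctx F) (a' : GTm F), t' = C'.fill a' ∧ Match E Q a a' ∧
      ∀ c c', Match E Q c c' → Match E Q (C.fill c) (C'.fill c') := by
  induction C generalizing t' with
  | hole => exact ⟨.hole, t', rfl, h, fun c c' h => h⟩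
  | app f l C r ih =>
    obtain ⟨f, l₀⟩ := f
    obtain ⟨ts', rfl, hE, h⟩ := h.inv (hC [] l₀ (by simp) rfl)
    obtain ⟨l', m, hl', hm, rfl⟩ := forall₂_append_left h
    cases hm with
    | cons h1 h2 =>
      obtain ⟨C', a', rfl, ha, hc⟩ := ih (fun p k hp hk =>
        hC ((l.length + 1) :: p) k (by simpa [Ctx.pos, List.cons_prefix_cons] using hp)
          (by simpa [Ctx.fill] using hk)) h1
      refine ⟨.app f l' C' _, a', rfl, ha, fun c c' hcc => ?_⟩
      exact .keep f l₀ _ _ (by simp) (List.rel_append hl' (.cons (hc c c' hcc) h2))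

theorem Match.subst {σ : V → LGTm F A} {σ' : V → GTm F} (l : Label A) (p : Tm F V)
    (h : ∀ x ∈ p.vars, Match ∅ Q (σ x) (σ' x)) :
    Match ∅ Q ((labelAll l p).subst σ) (p.subst σ') := by
  induction p using Tm.induct with
  | hv x => simpa [labelAll, Tm.map, Tm.subst, Tm.vars] using h
  | ha f ts ih =>
    simp only [labelAll, Tm.map, Tm.subst, List.map_map]
    refine .keep f l _ _ (by simp) ?_
    rw [forall₂_map_left_iff, forall₂_map_right_iff, forall₂_same]
    intro t ht
    refine ih t ht fun x hx => h x ?_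
    simp only [Tm.vars, List.mem_flatMap]
    exact ⟨t, ht, hx⟩

/-- A term that matches an instance of a relevant pattern is an instance of this pattern, provided
that the matching is rigid on the repeated variables. -/
theorem Match.exists_subst [DecidableEq V] {σ : V → LGTm F A} {p : LTm F A V} {t' : GTm F}
    (h : Match ∅ Q (p.subst σ) t') (hl : ∀ l ∈ labels p, (↑l : Set A) ⊆ Q)
    (hr : ∀ x, 2 ≤ p.vars.count x → ∀ u, Match ∅ Q (σ x) u → u = erase (σ x)) :
    ∃ σ' : V → GTm F, t' = (erase p).subst σ' ∧ ∀ x ∈ p.vars, Match ∅ Q (σ x) (σ' x) := by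
  induction p using Tm.induct generalizing t' with
  | hv x => exact ⟨fun _ => t', by simp [erase, Tm.map, Tm.subst], by
      simpa [Tm.vars, Tm.subst] using h⟩
  | ha f ts ih =>
    obtain ⟨f, l⟩ := f
    simp only [labels_app, List.mem_cons, List.mem_flatMap, forall_eq_or_imp] at hl
    simp only [Tm.subst] at h
    obtain ⟨ts', rfl, -, hts⟩ := h.inv hl.1
    clear h
    replace hl := hl.2
    rw [forall₂_map_left_iff] at hts
    simp only [Tm.vars] at hr ⊢
    suffices ∃ σ' : V → GTm F, ts' = ts.map (fun p => (erase p).subst σ') ∧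
        ∀ x ∈ ts.flatMap Tm.vars, Match ∅ Q (σ x) (σ' x) by
      obtain ⟨σ', rfl, h'⟩ := this
      exact ⟨σ', by simp [Tm.subst], h'⟩
    induction hts with
    -- With no patterns left the substitution is arbitrary.
    | nil => exact ⟨fun x => erase (σ x), rfl, by simp⟩
    | @cons p u ps us hp hps ih' =>
      simp only [List.flatMap_cons, List.count_append] at hr
      obtain ⟨σ₁, e₁, h₁⟩ := ih p (by simp) hp (fun l hl' => hl l ⟨p, by simp, hl'⟩)
        fun x hx => hr x (by omega)
      obtain ⟨σ₂, e₂, h₂⟩ := ih' (fun p hp => ih p (by simp [hp]))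
        (fun l ⟨p, hp, hl'⟩ => hl l ⟨p, by simp [hp], hl'⟩) fun x hx => hr x (by omega)
      -- The substitutions found for the first pattern and for the others are glued. A variable in
      -- both parts occurs at least twice, so rigidity forces both values to be `erase (σ x)`.
      refine ⟨fun x => if x ∈ p.vars then σ₁ x else σ₂ x, ?_, fun x hx => ?_⟩
      · rw [List.map_cons, e₁, e₂]
        congr 1
        · refine Tm.subst_congr _ fun x hx => ?_
          rw [erase, Tm.vars_map] at hx
          simp [hx]
        · refine List.map_congr_left fun q hq => Tm.subst_congr _ fun x hx => ?_
          rw [erase, Tm.vars_map] at hx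
          have hx : x ∈ ps.flatMap Tm.vars := List.mem_flatMap.2 ⟨q, hq, hx⟩
          split_ifs with hxp
          · have c1 : 0 < (ps.flatMap fun t => t.vars).count x := List.count_pos_iff.2 hx
            have c2 := List.count_pos_iff.2 hxp
            have := hr x (by omega)
            rw [this _ (h₁ x hxp), this _ (h₂ x hx)]
          · rfl
      · dsimp only
        split_ifs with hxp
        · exact h₁ x hxp
        · rw [List.flatMap_cons, List.mem_append] at hx
          exact h₂ x (hx.resolve_left hxp)

end Match

/-! ### Equality modulo associativity and commutativity of variadic terms -/

section AC

variable {S F V A : Type*} (R : Theory S F V)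

/-- Right-nested binary applications of `f` to the listed terms. -/
def foldApp (f : F) : List (GTm F) → GTm F
  | [] => .app f []
  | [x] => x
  | x :: y :: l => .app f [x, foldApp f (y :: l)]

open scoped Classical in
/-- Replace the variadic occurrences of associative-commutative symbols by nested binary ones. -/
noncomputable def Theory.binarize : GTm F → GTm F
  | .var x => .var x
  | .app f ts =>
    if f ∈ R.ac then foldApp f (ts.map fun t => binarize t)
    else .app f (ts.map fun t => binarize t)

variable {R}

theorem binarize_ac {f : F} (hf : f ∈ R.ac) (ts : List (GTm F)) :
    R.binarize (.app f ts) = foldApp f (ts.map R.binarize) := by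
  rw [Theory.binarize, if_pos hf]

theorem binarize_not_ac {f : F} (hf : f ∉ R.ac) (ts : List (GTm F)) :
    R.binarize (.app f ts) = .app f (ts.map R.binarize) := by
  rw [Theory.binarize, if_neg hf]

theorem foldApp_cons (f : F) (x : GTm F) {l : List (GTm F)} (hl : l ≠ []) :
    foldApp f (x :: l) = .app f [x, foldApp f l] := by
  cases l with
  | nil => exact absurd rfl hl
  | cons y l => rfl

theorem Theory.ACEq.app (f : F) {xs ys : List (GTm F)} (h : Forall₂ R.ACEq xs ys) :
    R.ACEq (.app f xs) (.app f ys) := by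
  -- The arguments are rewritten one at a time; `pre` collects those already replaced.
  suffices ∀ pre, R.ACEq (.app f (pre ++ xs)) (.app f (pre ++ ys)) from this []
  induction h with
  | nil => exact fun pre => .refl _
  | @cons x y xs ys h _ ih =>
    intro pre
    refine .trans (.ctx (.app f pre .hole xs) h) ?_
    simpa [Ctx.fill] using ih (pre ++ [y])

theorem Theory.ACEq.pair (f : F) {a a' b b' : GTm F} (ha : R.ACEq a a') (hb : R.ACEq b b') :
    R.ACEq (.app f [a, b]) (.app f [a', b']) :=
  .app f (.cons ha (.cons hb .nil))

theorem foldApp_congr (f : F) {xs ys : List (GTm F)} (h : Forall₂ R.ACEq xs ys) :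
    R.ACEq (foldApp f xs) (foldApp f ys) := by
  induction h with
  | nil => exact .refl _
  | @cons x y xs ys h h' ih =>
    cases h' with
    | nil => exact h
    | cons _ _ => exact .pair f h ih

/-- Reassociation moves the nested tail out of the last argument. Both lists must be nonempty, as
`foldApp` of the empty list is a junk value. -/
theorem foldApp_append {f : F} (hf : f ∈ R.ac) {xs ys : List (GTm F)} (hx : xs ≠ [])
    (hy : ys ≠ []) :
    R.ACEq (foldApp f (xs ++ ys)) (.app f [foldApp f xs, foldApp f ys]) := by
  induction xs with
  | nil => exact absurd rfl hx
  | cons x xs ih =>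
    rcases eq_or_ne xs [] with rfl | hxs
    · rw [List.singleton_append, foldApp_cons f x hy]
      exact .refl _
    · rw [List.cons_append, foldApp_cons f x (by simp [hxs]), foldApp_cons f x hxs]
      exact .trans (.pair f (.refl _) (ih hxs)) (.assoc f hf _ _ _)

theorem foldApp_perm {f : F} (hf : f ∈ R.ac) {xs ys : List (GTm F)} (h : xs.Perm ys) :
    R.ACEq (foldApp f xs) (foldApp f ys) := by
  induction h with
  | nil => exact .refl _
  | @cons x xs ys h ih =>
    rcases eq_or_ne xs [] with rfl | hxs
    · rw [List.nil_perm.1 h]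
      exact .refl _
    · rw [foldApp_cons f x hxs, foldApp_cons f x fun e => hxs (List.perm_nil.1 (e ▸ h))]
      exact .pair f (.refl _) ih
  | swap x y l =>
    rcases eq_or_ne l [] with rfl | hl
    · exact .comm f hf _ _
    · rw [foldApp_cons f y (List.cons_ne_nil x l), foldApp_cons f x (List.cons_ne_nil y l),
        foldApp_cons f x hl, foldApp_cons f y hl]
      -- `x(yl) = (xy)l = (yx)l = y(xl)`, up to the names of the two elements.
      exact .trans (.assoc f hf _ _ _)
        (.trans (.pair f (.comm f hf _ _) (.refl _)) (.symm (.assoc f hf _ _ _)))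
  | trans _ _ h₁ h₂ => exact .trans h₁ h₂

theorem binarize_congr (f : F) {xs ys : List (GTm F)}
    (h : Forall₂ (fun x y => R.ACEq (R.binarize x) (R.binarize y)) xs ys) :
    R.ACEq (R.binarize (.app f xs)) (R.binarize (.app f ys)) := by
  have h' : Forall₂ R.ACEq (xs.map R.binarize) (ys.map R.binarize) := by
    rwa [forall₂_map_left_iff, forall₂_map_right_iff]
  by_cases hf : f ∈ R.ac
  · rw [binarize_ac hf, binarize_ac hf]
    exact foldApp_congr f h'
  · rw [binarize_not_ac hf, binarize_not_ac hf]
    exact .app f h'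

theorem length_eq_two_of_ac {W : Type*} {ws : W → S} {f : F} (hf : f ∈ R.ac)
    {ts : List (Tm F W)} {s : S} (h : HasSort R.dom R.cod ws (.app f ts) s) :
    ∃ a b, ts = [a, b] := by
  have := (hasSort_app.1 h).2.length_eq
  rw [R.ac_rank f hf] at this
  exact List.length_eq_two.1 this

/-- In a well-sorted term every associative-commutative symbol is already binary. -/
theorem binarize_eq_self {t : GTm F} {s : S} (h : HasSort R.dom R.cod Empty.elim t s) :
    R.binarize t = t := by
  induction t using Tm.ground_induct generalizing s with
  | ha f ts ih =>
    have e : ts.map R.binarize = ts := by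
      refine (List.map_congr_left fun t ht => ?_).trans (List.map_id ts)
      obtain ⟨i, hi⟩ := List.mem_iff_getElem?.1 ht
      obtain ⟨hlen, h⟩ := forall₂_iff_getElem?.1 (hasSort_app.1 h).2
      obtain ⟨hi', -⟩ := List.getElem?_eq_some_iff.1 hi
      exact ih t ht (h i t _ hi (List.getElem?_eq_getElem (hlen ▸ hi')))
    by_cases hf : f ∈ R.ac
    · rw [binarize_ac hf, e]
      obtain ⟨a, b, rfl⟩ := length_eq_two_of_ac hf h
      rfl
    · rw [binarize_not_ac hf, e]

theorem Theory.ACEq.hasSort_iff {t u : GTm F} (h : R.ACEq t u) (s : S) :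
    HasSort R.dom R.cod Empty.elim t s ↔ HasSort R.dom R.cod Empty.elim u s := by
  induction h generalizing s with
  | comm f hf x y => simp [hasSort_app, R.ac_rank f hf, and_comm]
  | assoc f hf x y z => simp [hasSort_app, R.ac_rank f hf, and_assoc]
  | refl => rfl
  | symm _ ih => exact (ih s).symm
  | trans _ _ ih₁ ih₂ => exact (ih₁ s).trans (ih₂ s)
  | ctx C _ ih => exact ⟨hasSort_fill fun s => (ih s).1, hasSort_fill fun s => (ih s).2⟩

-- Simulation of flattening and unflattening on concretizations

variable {Q : Set A}

/-- Strengthens the match for use on variadic terms: sorting excludes associative-commutative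
symbols without arguments, for which the nested form would break down. -/
theorem Match.of_hasSort {t : LGTm F A} {t' : GTm F} {s : S} (h : Match ∅ Q t t')
    (hs : HasSort R.dom R.cod Empty.elim t' s) : Match R.ac Q t t' := by
  induction t using Tm.ground_induct generalizing t' s with
  | ha f ts ih =>
    cases h with
    | cut f l _ _ h => exact .cut f l ts t' h
    | keep f l _ ts' _ h =>
      obtain ⟨hlen, h⟩ := forall₂_iff_getElem?.1 h
      refine .keep f l ts ts' ?_ (forall₂_iff_getElem?.2 ⟨hlen, fun i a b ha hb => ?_⟩)
      · rintro hf rfl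
        obtain ⟨a, b, rfl⟩ := length_eq_two_of_ac hf hs
        simp at hlen
      · obtain ⟨hlen', h'⟩ := forall₂_iff_getElem?.1 (hasSort_app.1 hs).2
        obtain ⟨hi, -⟩ := List.getElem?_eq_some_iff.1 hb
        exact ih a (List.mem_of_getElem? ha) (h i a b ha hb)
          (h' i b _ hb (List.getElem?_eq_getElem (hlen' ▸ hi)))

/-- A kept associative-commutative symbol has two arguments in the well-sorted `erase t`, hence also
in `t'`, and binarizing leaves such a node in place. -/
theorem Match.binarize {E : Set F} {t : LGTm F A} {t' : GTm F} {s : S} (h : Match E Q t t')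
    (hs : HasSort R.dom R.cod Empty.elim (erase t) s) : Match ∅ Q t (R.binarize t') := by
  induction t using Tm.ground_induct generalizing t' s with
  | ha f ts ih =>
    cases h with
    | cut f l _ _ h => exact .cut f l ts _ h
    | keep f l _ ts' _ h =>
      rw [erase_app] at hs
      have h2 : Forall₂ (Match ∅ Q) ts (ts'.map R.binarize) := by
        rw [forall₂_map_right_iff]
        obtain ⟨hlen, h⟩ := forall₂_iff_getElem?.1 h
        refine forall₂_iff_getElem?.2 ⟨hlen, fun i a b ha hb => ?_⟩
        obtain ⟨hlen', h'⟩ := forall₂_iff_getElem?.1 (hasSort_app.1 hs).2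
        obtain ⟨hi, -⟩ := List.getElem?_eq_some_iff.1 ha
        rw [List.length_map] at hlen'
        exact ih a (List.mem_of_getElem? ha) (h i a b ha hb)
          (h' i (erase a) _ (by simp [ha]) (List.getElem?_eq_getElem (hlen' ▸ hi)))
      by_cases hf : f ∈ R.ac
      · rw [binarize_ac hf]
        obtain ⟨a, b, e⟩ := length_eq_two_of_ac hf hs
        have hlen := h.length_eq
        have := congrArg List.length e
        rw [List.length_map, List.length_cons, List.length_singleton] at this
        obtain ⟨a', b', rfl⟩ := List.length_eq_two.1 (hlen.symm.trans this)
        exact .keep f l ts [R.binarize a', R.binarize b'] (by simp) h2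
      · rw [binarize_not_ac hf]
        exact .keep f l ts _ (by simp) h2

/-- Simulation of a local modification of a labeled term. -/
theorem Match.exists_fill {C : Ctx (F × Label A)} {a b : LGTm F A}
    (h : ∀ a', Match R.ac Q a a' →
      ∃ b', Match R.ac Q b b' ∧ R.ACEq (R.binarize a') (R.binarize b'))
    {t' : GTm F} (ht : Match R.ac Q (C.fill a) t') :
    ∃ u', Match R.ac Q (C.fill b) u' ∧ R.ACEq (R.binarize t') (R.binarize u') := by
  induction C generalizing t' with
  | hole => exact h t' ht
  | app f l C r ih =>
    cases ht with
    -- Above the hole a symbol is irrelevant, so the concretization need not change at all.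
    | cut f l₀ _ _ hl => exact ⟨t', .cut f l₀ _ t' hl, .refl _⟩
    | keep f l₀ _ ts' _ ht =>
      obtain ⟨l', m, hl', hm, rfl⟩ := forall₂_append_left ht
      cases hm with
      | @cons _ x _ r' h1 h2 =>
        obtain ⟨u', hu, e⟩ := ih h1
        refine ⟨.app f (l' ++ u' :: r'), .keep f l₀ _ _ (by simp)
          (List.rel_append hl' (.cons hu h2)), binarize_congr f ?_⟩
        exact List.rel_append (forall₂_same.2 fun _ _ => .refl _)
          (.cons e (forall₂_same.2 fun _ _ => .refl _))

theorem exists_perm_forall₂ {α β : Type*} {r : α → β → Prop} {as as' : List α} {bs : List β}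
    (hp : as'.Perm as) (h : Forall₂ r as bs) : ∃ bs', Forall₂ r as' bs' ∧ bs'.Perm bs := by
  exact List.perm_comp_forall₂ hp h

/-- All merged occurrences of `f` are relevant, so they are present in `t'` too and can be dissolved
there in parallel. Nonemptiness of the result keeps `foldApp_append` applicable. -/
theorem Match.flatArgs [DecidableEq F] {f : F} (hf : f ∈ R.ac) {t : LGTm F A} {t' : GTm F}
    (h : Match R.ac Q t t') (hl : ∀ l ∈ topLabels f t, (↑l : Set A) ⊆ Q) :
    ∃ us, us ≠ [] ∧ Forall₂ (Match R.ac Q) (flatArgs f t) us ∧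
      R.ACEq (R.binarize t') (foldApp f (us.map R.binarize)) := by
  induction t using Tm.ground_induct generalizing t' with
  | ha g ts ih =>
    obtain ⟨g, l⟩ := g
    by_cases hg : g = f
    · subst hg
      simp only [topLabels, if_true, List.mem_cons, List.mem_flatMap, forall_eq_or_imp] at hl
      obtain ⟨ts', rfl, hE, hts⟩ := h.inv hl.1
      clear h
      replace hl := hl.2
      replace hE := hE hf
      rw [binarize_ac hf]
      simp only [TraceSlicing.flatArgs, if_true]
      induction hts with
      | nil => exact absurd rfl hE
      | @cons t t' ts ts' ht hts ih' =>
        obtain ⟨us, hus, hm, e⟩ := ih t (by simp) ht fun l hl' => hl l ⟨t, by simp, hl'⟩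
        rcases eq_or_ne ts [] with rfl | hne
        · cases hts
          exact ⟨us, hus, by simpa using hm, e⟩
        · obtain ⟨vs, hvs, hm', e'⟩ := ih' (fun t ht => ih t (by simp [ht]))
            (fun l ⟨t, ht, hl'⟩ => hl l ⟨t, by simp [ht], hl'⟩) hne
          refine ⟨us ++ vs, by simp [hus], ?_, ?_⟩
          · rw [List.flatMap_cons]
            exact List.rel_append hm hm'
          · have hne' : ts'.map R.binarize ≠ [] := by
              rintro h0
              exact hne (List.length_eq_zero_iff.1
                (hts.length_eq.trans (by simpa using congrArg List.length h0)))
            rw [List.map_cons, foldApp_cons g _ hne', List.map_append]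
            exact .trans (.pair g e e')
              (.symm (foldApp_append hf (by simpa using hus) (by simpa using hvs)))
    · simp only [TraceSlicing.flatArgs, if_neg hg]
      exact ⟨[t'], by simp, .cons h .nil, .refl _⟩

theorem Match.flatStep [DecidableEq F] [DecidableEq A] {t u : LGTm F A} (hs : R.FlatStep t u) {t' : GTm F}
    (h : Match R.ac Q t t') :
    ∃ u', Match R.ac Q u u' ∧ R.ACEq (R.binarize t') (R.binarize u') := by
  cases hs with
  | mk C f hf l ts us hu =>
    refine h.exists_fill fun a' ha => ?_
    -- If the joined label is irrelevant, the flattened symbol is cut and the old subterm still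
    -- matches it. Otherwise each merged label is relevant.
    by_cases hl : (↑(join (topLabels f (.app (f, l) ts))) : Set A) ⊆ Q
    · obtain ⟨vs, hvs, hm, e⟩ := ha.flatArgs hf fun l' hl' => subset_of_join_subset hl hl'
      obtain ⟨ws, hws, hp⟩ := exists_perm_forall₂ hu hm
      refine ⟨.app f ws, .keep f _ us ws ?_ hws, ?_⟩
      · rintro - rfl
        cases hws
        exact hvs (List.nil_perm.1 hp)
      · rw [binarize_ac hf ws]
        exact .trans e (foldApp_perm hf (hp.map _).symm)
    · exact ⟨a', .cut f _ us a' hl, .refl _⟩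

/-- The binary tree over the listed terms is copied with their counterparts as leaves; `B`
identifies it with the right-nested form. -/
theorem Nested.exists_match {f : F} (hf : f ∈ R.ac) {l : Label A} {us : List (LGTm F A)}
    {t : LGTm F A} (h : Nested f l us t) {us' : List (GTm F)}
    (hm : Forall₂ (Match R.ac Q) us us') :
    us' ≠ [] ∧
      ∃ t', Match R.ac Q t t' ∧ R.ACEq (foldApp f (us'.map R.binarize)) (R.binarize t') := by
  induction h generalizing us' with
  | leaf g l' ts hg =>
    cases hm with
    | cons h1 h2 =>
      cases h2
      exact ⟨by simp, _, h1, .refl _⟩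
  | node us vs t u _ _ iht ihu =>
    obtain ⟨us', vs', h1, h2, rfl⟩ := forall₂_append_left hm
    obtain ⟨hu, t', ht, e⟩ := iht h1
    obtain ⟨hv, u', hu', e'⟩ := ihu h2
    refine ⟨by simp [hu], .app f [t', u'], .keep f l _ _ (by simp) (.cons ht (.cons hu' .nil)), ?_⟩
    rw [binarize_ac hf, List.map_append]
    exact .trans (foldApp_append hf (by simpa using hu) (by simpa using hv)) (.pair f e e')

theorem Match.unflatStep {t u : LGTm F A} (hs : R.UnflatStep t u) {t' : GTm F}
    (h : Match R.ac Q t t') :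
    ∃ u', Match R.ac Q u u' ∧ R.ACEq (R.binarize t') (R.binarize u') := by
  cases hs with
  | mk C f hf l us vs h2 hp t ht =>
    refine h.exists_fill fun a' ha => ?_
    by_cases hl : (↑l : Set A) ⊆ Q
    · obtain ⟨us', rfl, -, hm⟩ := ha.inv hl
      obtain ⟨vs', hvs, hp'⟩ := exists_perm_forall₂ hp hm
      obtain ⟨-, b', hb, e⟩ := ht.exists_match hf hvs
      refine ⟨b', hb, ?_⟩
      rw [binarize_ac hf]
      exact .trans (foldApp_perm hf (hp'.map _).symm) e
    · refine ⟨a', ?_, .refl _⟩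
      cases ht with
      | leaf g l' ts hg =>
        -- A bare leaf cannot arise from at least two arguments, so the root of the result carries
        -- the irrelevant label.
        have := hp.length_eq
        rw [List.length_singleton] at this
        omega
      | node => exact .cut f l _ a' hl

/-- Simulation of a labeled equality step modulo `B`. -/
theorem Match.acStep [DecidableEq F] [DecidableEq A] {t s u : LGTm F A}
    (hflat : Relation.ReflTransGen R.FlatStep t s)
    (hunflat : Relation.ReflTransGen R.UnflatStep s u) (hu : R.IsGround (erase u)) {t' : GTm F}
    (ht' : R.IsGround t') (h : Match ∅ Q t t') :
    ∃ u', R.Step .ac t' u' ∧ Match ∅ Q u u' := by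
  obtain ⟨st, hst⟩ := ht'
  obtain ⟨su, hsu⟩ := hu
  have h0 := h.of_hasSort hst
  have h1 : ∃ s', Match R.ac Q s s' ∧ R.ACEq (R.binarize t') (R.binarize s') := by
    clear hunflat
    induction hflat with
    | refl => exact ⟨t', h0, .refl _⟩
    | tail _ hs ih =>
      obtain ⟨s', hm, e⟩ := ih
      obtain ⟨u', hm', e'⟩ := hm.flatStep hs
      exact ⟨u', hm', .trans e e'⟩
  have h2 : ∃ u', Match R.ac Q u u' ∧ R.ACEq (R.binarize t') (R.binarize u') := by
    clear hsu hflat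
    induction hunflat with
    | refl => exact h1
    | tail _ hs ih =>
      obtain ⟨s', hm, e⟩ := ih
      obtain ⟨u', hm', e'⟩ := hm.unflatStep hs
      exact ⟨u', hm', .trans e e'⟩
  obtain ⟨u', hm, e⟩ := h2
  rw [binarize_eq_self hst] at e
  -- The simulating `u'` may be variadic; its binary form is the target of the step, well sorted
  -- because `B` preserves sorts.
  exact ⟨R.binarize u', ⟨⟨st, hst⟩, ⟨st, (e.hasSort_iff st).1 hst⟩, .ac _ _ e⟩, hm.binarize hsu⟩

end AC

/-! ### Simulation of a labeled step -/

section Steps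

variable {S F V A : Type*}

/-- The atomic labels of the symbols at or above a position of `P`. -/
def relevantAtoms (s : LGTm F A) (P : Set Pos) : Set A :=
  {a | ∃ w ∈ P, ∃ p l, p <+: w ∧ labelAt p s = some l ∧ a ∈ l}

theorem subset_relevantAtoms {s : LGTm F A} {P : Set Pos} {p w : Pos} {l : Label A} (hw : w ∈ P)
    (hp : p <+: w) (hl : labelAt p s = some l) : (↑l : Set A) ⊆ relevantAtoms s P :=
  fun _ ha => ⟨w, hw, p, l, hp, hl, ha⟩

theorem mem_origins_of_mem {t s : LGTm F A} {P : Set Pos} {v : Pos} {a : A}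
    (hv : labelAt v t = some {a}) (ha : a ∈ relevantAtoms s P) : v ∈ ⋃ w ∈ P, origins t s w := by
  obtain ⟨w, hw, p, l, hp, hl, ha⟩ := ha
  exact Set.mem_biUnion hw ⟨p, _, l, hp, hv, hl, by simpa using ha⟩

theorem match_relevantAtoms {t s : LGTm F A} {P : Set Pos} {t' : GTm F}
    (ht : ∀ l ∈ labels t, ∃ a, l = {a})
    (h : Instantiates (slRec (⋃ w ∈ P, origins t s w) [] (erase t)) t') :
    Match ∅ (relevantAtoms s P) t t' := by
  refine match_of_instantiates (fun q l hq hl => ⟨[], ?_⟩) h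
  obtain ⟨a, rfl⟩ := ht l (mem_labels_of_labelAt hq)
  rw [List.append_nil]
  exact mem_origins_of_mem hq (hl (by simp))

theorem Match.instantiates_slice {E : Set F} {Q : Set A} {s : LGTm F A} {P : Set Pos} {s' : GTm F}
    (hQ : relevantAtoms s P ⊆ Q) (h : Match E Q s s') :
    Instantiates (slRec P [] (erase s)) s' :=
  h.instantiates fun q _ hq ⟨w, hw⟩ =>
    (subset_relevantAtoms hw (show q <+: [] ++ q ++ w from List.prefix_append q w) hq).trans hQ

/-- If the hole is irrelevant, then a step below it does not change the slice. -/
theorem slice_fill_eq {C : Ctx (F × Label A)} {a b : LGTm F A} {P : Set Pos}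
    (hsing : ∀ l ∈ labels (C.fill a), ∃ x, l = {x}) (hC : (ctxLabels C).Nodup)
    (hdisj : ∀ l ∈ ctxLabels C, l ∉ labels a) (hP : ¬ ∃ w, C.pos ++ w ∈ P) :
    slRec (⋃ w ∈ P, origins (C.fill a) (C.fill b) w) [] (erase (C.fill a)) =
      slRec P [] (erase (C.fill b)) := by
  classical
  -- An origin arises from a position of the context, where source and target carry the same
  -- singleton label; that label occurs once in the source, so the origin is that very position.
  have key : ∀ v ∈ ⋃ w ∈ P, origins (C.fill a) (C.fill b) w,
      ¬ C.pos <+: v ∧ ∃ w ∈ P, v <+: w := by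
    intro v hv
    obtain ⟨w, hw, p, lv, lp, hpw, hlv, hlp, hsub⟩ := Set.mem_iUnion₂.1 hv
    have hp : ¬ C.pos <+: p := by
      intro h
      obtain ⟨q, rfl⟩ := h.trans hpw
      exact hP ⟨q, hw⟩
    rw [Ctx.labelAt_fill_congr C b a hp] at hlp
    have hmem := Ctx.mem_ctxLabels_of_labelAt hp hlp
    obtain ⟨x, rfl⟩ := hsing lv (mem_labels_of_labelAt hlv)
    obtain ⟨y, rfl⟩ := hsing lp (mem_labels_of_labelAt hlp)
    obtain rfl : x = y := by simpa using hsub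
    -- Counting this one label is necessary: nonlinear patterns duplicate labels inside the redex,
    -- so the labels of the whole source need not be distinct.
    have hcount : (labels (C.fill a)).count {x} ≤ 1 := by
      rw [(Ctx.labels_fill_perm C a).count_eq, List.count_append,
        List.count_eq_zero_of_not_mem (hdisj _ hmem)]
      exact List.nodup_iff_count_le_one.1 hC _
    obtain rfl := labelAt_inj hcount hlv hlp
    exact ⟨hp, w, hw, hpw⟩
  refine slRec_fill_congr C a b (fun q l hq hl => ⟨?_, ?_⟩) ?_ (by simpa using hP)
  · rintro ⟨w, hw⟩
    obtain ⟨-, w', hw', hpre⟩ := key _ hw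
    obtain ⟨k, rfl⟩ := (List.prefix_append ([] ++ q) w).trans hpre
    exact ⟨k, hw'⟩
  · rintro ⟨w, hw⟩
    refine ⟨[], ?_⟩
    rw [List.append_nil, List.nil_append]
    refine Set.mem_biUnion hw ⟨q, l, l, List.prefix_append q w, hl, ?_, subset_rfl⟩
    rw [Ctx.labelAt_fill_congr C b a hq, hl]
  · rintro ⟨w, hw⟩
    exact (key _ hw).1 (List.prefix_append C.pos w)

theorem slRec_eq_of_empty (t u : GTm F) (p p' : Pos) :
    slRec ∅ p t = slRec ∅ p' u := by
  rw [slRec_of_not_mem (by simp), slRec_of_not_mem (by simp)]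

theorem mem_labels_subst {p : LTm F A V} {σ : V → LGTm F A} {l : Label A}
    (h : l ∈ labels (p.subst σ)) : l ∈ labels p ∨ ∃ x ∈ p.vars, l ∈ labels (σ x) := by
  induction p using Tm.induct with
  | hv x => exact .inr ⟨x, by simp [Tm.vars], by rwa [Tm.subst] at h⟩
  | ha f ts ih =>
    obtain ⟨f, l₀⟩ := f
    simp only [Tm.subst, labels_app, List.mem_cons, List.mem_flatMap, List.mem_map,
      exists_exists_and_eq_and, Tm.vars] at h ⊢
    rcases h with rfl | ⟨t, ht, h⟩
    · exact .inl (.inl rfl)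
    · rcases ih t ht h with h | ⟨x, hx, h⟩
      · exact .inl (.inr ⟨t, ht, h⟩)
      · exact .inr ⟨x, ⟨t, ht, hx⟩, h⟩

theorem labelAll_app (l : Label A) (f : F) (ts : List (Tm F V)) :
    labelAll l (.app f ts) = .app (f, l) (ts.map (labelAll l)) := by
  simp only [labelAll, Tm.map]
  rfl

theorem labelAt_addRootLabel [DecidableEq A] (l : Label A) (t : LGTm F A) :
    labelAt [] (addRootLabel l t) = (labelAt [] t).map (l ∪ ·) := by
  match t with
  | .var x => exact x.elim
  | .app (f, l₀) ts => rfl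

/-- This is where the root labels of the contractum do their work. The pattern label sits on the
root symbol of the right-hand side, or is added there if the rule is collapsing; the labels of
repeated variables are added in either case. -/
theorem exists_labelAt_labeledContractum [DecidableEq V] [DecidableEq A]
    (r : Rule F V) (lhs : LTm F A V) (σ : V → LGTm F A) :
    ∃ l, labelAt [] (labeledContractum r lhs σ) = some l ∧ join (labels lhs) ⊆ l ∧
      ∀ x, 2 ≤ r.lhs.vars.count x → ∀ k ∈ labels (σ x), k ⊆ l := by
  have hrep : ∀ x, 2 ≤ r.lhs.vars.count x → ∀ k ∈ labels (σ x),
      k ⊆ join ((r.lhs.vars.dedup.filter fun x => 2 ≤ r.lhs.vars.count x).flatMap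
        fun x => labels (σ x)) := by
    intro x hx k hk a ha
    refine mem_join.2 ⟨k, List.mem_flatMap.2 ⟨x, ?_, hk⟩, ha⟩
    rw [List.mem_filter, List.mem_dedup]
    exact ⟨List.count_pos_iff.1 (by omega), by simpa using hx⟩
  suffices ∃ l, labelAt [] (open scoped Classical in
      if r.rhs.IsVar then
        addRootLabel (join (labels lhs)) ((labelAll (join (labels lhs)) r.rhs).subst σ)
      else (labelAll (join (labels lhs)) r.rhs).subst σ) = some l ∧ join (labels lhs) ⊆ l by
    obtain ⟨l, hl, hsub⟩ := this
    refine ⟨_ ∪ l, ?_, hsub.trans Finset.subset_union_right,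
      fun x hx k hk => (hrep x hx k hk).trans Finset.subset_union_left⟩
    rw [labeledContractum, labelAt_addRootLabel, hl]
    rfl
  split_ifs with hv
  · obtain ⟨l, hl⟩ := exists_labelAt_nil ((labelAll (join (labels lhs)) r.rhs).subst σ)
    exact ⟨join (labels lhs) ∪ l, by rw [labelAt_addRootLabel, hl]; rfl, Finset.subset_union_left⟩
  · match hr : r.rhs with
    | .var x => exact absurd (by rw [hr]; trivial) hv
    | .app f ts => exact ⟨_, by rw [labelAll_app, Tm.subst, labelAt_nil], subset_rfl⟩

theorem Match.labeledContractum [DecidableEq V] [DecidableEq A]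
    {Q : Set A} {r : Rule F V} (lhs : LTm F A V) {σ : V → LGTm F A}
    {σ' : V → GTm F} (h : ∀ x ∈ r.rhs.vars, Match ∅ Q (σ x) (σ' x)) :
    Match ∅ Q (labeledContractum r lhs σ) (r.rhs.subst σ') := by
  refine Match.addRootLabel ?_ _
  have := Match.subst (join (labels lhs)) r.rhs h
  split_ifs
  · exact this.addRootLabel _
  · exact this

-- Simulation of rules and built-in operators

variable {R : Theory S F V} {P : Set Pos} {t' : GTm F}

theorem step_rule {r : Rule F V} (hr : r ∈ R.rules ∪ R.eqns) {C : Ctx F} {σ : V → GTm F}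
    (h : R.IsGround (C.fill (r.lhs.subst σ))) :
    R.Step (.rule r) (C.fill (r.lhs.subst σ)) (C.fill (r.rhs.subst σ)) := by
  obtain ⟨s, hs⟩ := h
  obtain ⟨s₀, hl, hrhs⟩ := R.well_sorted r hr
  obtain ⟨s₁, h₁⟩ := hasSort_of_fill hs
  -- The left-hand side is not a variable, so its root symbol fixes the sort of the instance.
  have hu : s₁ = s₀ := by
    have hnv := R.lhs_not_var r hr
    match hr : r.lhs with
    | .var x => rw [hr] at hnv; exact absurd trivial hnv
    | .app f ts =>
      rw [hr] at hl h₁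
      rw [Tm.subst] at h₁
      exact (hasSort_app.1 h₁).1.symm.trans (hasSort_app.1 hl).1
  subst hu
  have hσ := hasSort_of_subst r.lhs hl h₁
  refine ⟨⟨s, hs⟩, ⟨s, hasSort_fill (fun s' hs' => ?_) hs⟩, .rule r hr C σ hσ⟩
  rw [← h₁.unique hs']
  exact hrhs.subst r.rhs fun x hx => hσ x (R.vars_subset r hr hx)

theorem step_builtin {op : F} {args : List (GTm F)} {t : GTm F} (hb : R.builtin op args t)
    {C : Ctx F} (h : R.IsGround (C.fill (.app op args))) :
    R.Step (.builtin op) (C.fill (.app op args)) (C.fill t) := by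
  obtain ⟨s, hs⟩ := h
  refine ⟨⟨s, hs⟩, ⟨s, hasSort_fill (fun s' hs' => ?_) hs⟩, .builtin C op args t hb⟩
  rw [← (R.builtin_sorted op args t hb).1.unique hs']
  exact (R.builtin_sorted op args t hb).2

theorem rule_sound [DecidableEq V] [DecidableEq A]
    {r : Rule F V} (hr : r ∈ R.rules ∪ R.eqns) {C : Ctx (F × Label A)}
    {lhs : LTm F A V} (hlhs : erase lhs = r.lhs) {σ : V → LGTm F A}
    (hinit : IsInitial
      (ctxLabels C ++ labels lhs ++ r.lhs.vars.dedup.flatMap fun x => labels (σ x)))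
    (ht' : R.IsGround t')
    (hi : Instantiates (slRec (⋃ w ∈ P, origins (C.fill (lhs.subst σ))
      (C.fill (labeledContractum r lhs σ)) w) [] (erase (C.fill (lhs.subst σ)))) t') :
    slRec (⋃ w ∈ P, origins (C.fill (lhs.subst σ)) (C.fill (labeledContractum r lhs σ)) w) []
        (erase (C.fill (lhs.subst σ))) =
      slRec P [] (erase (C.fill (labeledContractum r lhs σ))) ∨
    ∃ u', R.Step (.rule r) t' u' ∧
      Instantiates (slRec P [] (erase (C.fill (labeledContractum r lhs σ)))) u' := by
  have hvars : lhs.vars = r.lhs.vars := by rw [← hlhs, erase, Tm.vars_map]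
  have hsub : ∀ l ∈ labels (lhs.subst σ),
      l ∈ labels lhs ++ r.lhs.vars.dedup.flatMap fun x => labels (σ x) := by
    intro l hl
    rcases mem_labels_subst hl with h | ⟨x, hx, h⟩
    · exact List.mem_append_left _ h
    · exact List.mem_append_right _
        (List.mem_flatMap.2 ⟨x, List.mem_dedup.2 (hvars ▸ hx), h⟩)
  rw [List.append_assoc] at hinit
  have hsing : ∀ l ∈ labels (C.fill (lhs.subst σ)), ∃ a, l = {a} := by
    intro l hl
    refine hinit.2 l ?_
    rcases List.mem_append.1 ((Ctx.labels_fill_perm C _).subset hl) with h | h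
    · exact List.mem_append_left _ h
    · exact List.mem_append_right _ (hsub l h)
  obtain ⟨hC, -, hdisj⟩ := List.nodup_append'.1 hinit.1
  by_cases hP : ∃ w, C.pos ++ w ∈ P
  swap
  · exact .inl (slice_fill_eq hsing hC (fun l hl h => hdisj hl (hsub l h)) hP)
  right
  obtain ⟨w, hw⟩ := hP
  -- The position `w` lies at or below the hole, so every symbol from the root down to the root of
  -- the contractum is relevant.
  have hpath : ∀ p l, p <+: C.pos →
      labelAt p (C.fill (labeledContractum r lhs σ)) = some l →
      (↑l : Set A) ⊆ relevantAtoms (C.fill (labeledContractum r lhs σ)) P :=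
    fun p l hp hl => subset_relevantAtoms hw (hp.trans (List.prefix_append _ _)) hl
  obtain ⟨C', a', rfl, ha, hfill⟩ := (match_relevantAtoms hsing hi).of_fill hpath
  obtain ⟨l, hl, hjoin, hrep⟩ := exists_labelAt_labeledContractum r lhs σ
  have hlQ := hpath (C.pos ++ []) l (by simp) (by rw [Ctx.labelAt_fill, hl])
  obtain ⟨σ', rfl, hσ⟩ := ha.exists_subst
    (fun k hk => subset_of_join_subset ((Finset.coe_subset.2 hjoin).trans hlQ) hk)
    (fun x hx u hu => hu.eq_erase fun k hk =>
      (Finset.coe_subset.2 (hrep x (hvars ▸ hx) k hk)).trans hlQ)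
  rw [hlhs] at ht' ⊢
  refine ⟨_, step_rule hr ht', (hfill _ _ (Match.labeledContractum lhs fun x hx => hσ x ?_)
    ).instantiates_slice subset_rfl⟩
  rw [hvars]
  exact R.vars_subset r hr hx

theorem builtin_sound [DecidableEq A] {C : Ctx (F × Label A)} {op : F} {l : Label A} {args : List (LGTm F A)}
    {t : GTm F} (hb : R.builtin op (args.map erase) t)
    (hinit : IsInitial (labels (C.fill (.app (op, l) args)))) (ht' : R.IsGround t')
    (hi : Instantiates (slRec (⋃ w ∈ P, origins (C.fill (.app (op, l) args))
      (C.fill (labelAll (join (args.flatMap labels)) t)) w) []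
        (erase (C.fill (.app (op, l) args)))) t') :
    slRec (⋃ w ∈ P, origins (C.fill (.app (op, l) args))
        (C.fill (labelAll (join (args.flatMap labels)) t)) w) []
        (erase (C.fill (.app (op, l) args))) =
      slRec P [] (erase (C.fill (labelAll (join (args.flatMap labels)) t))) ∨
    ∃ u', R.Step (.builtin op) t' u' ∧
      Instantiates (slRec P [] (erase (C.fill (labelAll (join (args.flatMap labels)) t)))) u' := by
  obtain ⟨hC, -, hdisj⟩ := List.nodup_append'.1
    ((Ctx.labels_fill_perm C _).nodup_iff.1 hinit.1)
  by_cases hP : ∃ w, C.pos ++ w ∈ P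
  swap
  · exact .inl (slice_fill_eq hinit.2 hC (fun l hl h => hdisj hl h) hP)
  right
  obtain ⟨w, hw⟩ := hP
  set u := C.fill (labelAll (join (args.flatMap labels)) t) with hu
  have hpath : ∀ p k, p <+: C.pos → labelAt p u = some k →
      (↑k : Set A) ⊆ relevantAtoms u P :=
    fun p k hp hk => subset_relevantAtoms hw (hp.trans (List.prefix_append _ _)) hk
  have hjoin : (↑(join (args.flatMap labels)) : Set A) ⊆ relevantAtoms u P := by
    refine hpath (C.pos ++ []) _ (by simp) ?_
    rw [hu, Ctx.labelAt_fill]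
    cases t with
    | var x => exact x.elim
    | app f ts => rw [labelAll_app, labelAt_nil]
  have hop : labelAt C.pos (C.fill (.app (op, l) args)) = some l := by
    simpa using Ctx.labelAt_fill C (.app (op, l) args) []
  -- The label `l` of `op` is not passed on to the result, so it is adjoined to the relevant atoms.
  -- The symbol `op` survives in the slice nonetheless: there is a first argument, its root is an
  -- origin, and `op` lies above it.
  have hmatch : Match ∅ (relevantAtoms u P ∪ ↑l) (C.fill (.app (op, l) args)) t' := by
    refine match_of_instantiates (fun q k hq hk => ?_) hi
    obtain ⟨a, rfl⟩ := hinit.2 k (mem_labels_of_labelAt hq)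
    rcases hk (by simp : a ∈ _) with ha | ha
    · exact ⟨[], by simpa using mem_origins_of_mem hq ha⟩
    · obtain ⟨b, rfl⟩ := hinit.2 l (mem_labels_of_labelAt hop)
      obtain rfl : a = b := by simpa using ha
      obtain rfl := labelAt_inj (List.nodup_iff_count_le_one.1 hinit.1 _) hq hop
      match args, R.builtin_args _ _ _ hb with
      | x :: xs, _ =>
        obtain ⟨k, hk⟩ := exists_labelAt_nil x
        have hk' : labelAt (C.pos ++ [1]) (C.fill (.app (op, {a}) (x :: xs))) = some k := by
          rw [Ctx.labelAt_fill]
          simpa using hk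
        obtain ⟨c, rfl⟩ := hinit.2 k (mem_labels_of_labelAt hk')
        refine ⟨[1], mem_origins_of_mem hk' (hjoin (mem_join.2 ⟨{c}, ?_, by simp⟩))⟩
        exact List.mem_flatMap.2 ⟨x, by simp, mem_labels_of_labelAt hk⟩
  obtain ⟨C', a', rfl, ha, hfill⟩ := hmatch.of_fill (b := labelAll (join (args.flatMap labels)) t)
    fun p k hp hk => (hpath p k hp hk).trans Set.subset_union_left
  obtain rfl := ha.eq_erase fun k hk => by
    rw [labels_app, List.mem_cons] at hk
    rcases hk with rfl | hk
    · exact Set.subset_union_right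
    · exact (subset_of_join_subset hjoin hk).trans Set.subset_union_left
  rw [erase_app] at ht' ⊢
  refine ⟨_, step_builtin hb ht', (hfill _ t ?_).instantiates_slice Set.subset_union_left⟩
  have := match_erase (Q := relevantAtoms u P ∪ ↑l) (labelAll (join (args.flatMap labels)) t)
  rwa [erase_labelAll] at this

/-- A labeled step either preserves the slice or can be simulated on the concretizations of the
slice of its source. -/
theorem Theory.StepLabeling.sound [DecidableEq F] [DecidableEq V] [DecidableEq A]
    {n : StepName F V} {t u : LGTm F A}
    (h : R.StepLabeling n t u) (hu : R.IsGround (erase u)) (ht' : R.IsGround t')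
    (hi : Instantiates (slRec (⋃ w ∈ P, origins t u w) [] (erase t)) t') :
    slRec (⋃ w ∈ P, origins t u w) [] (erase t) = slRec P [] (erase u) ∨
    ∃ u', R.Step n t' u' ∧ Instantiates (slRec P [] (erase u)) u' := by
  cases h with
  | rule r hr C lhs hlhs σ hinit => exact rule_sound hr hlhs hinit ht' hi
  | builtin C op l args t hb hinit => exact builtin_sound hb hinit ht' hi
  | builtinAll C op l args t hb hinit =>
    -- For the empty context both conventions agree. Otherwise the root of the target carries all
    -- labels of the source, so a nonempty `P` forces `t'` to be the source itself; for empty `P`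
    -- both slices are `•`.
    cases C with
    | hole => exact builtin_sound (C := .hole) hb hinit ht' hi
    | app f ls C rs =>
      rcases P.eq_empty_or_nonempty with rfl | ⟨w, hw⟩
      · left
        simp only [Set.mem_empty_iff_false, Set.iUnion_of_empty, Set.iUnion_empty]
        exact slRec_eq_of_empty _ _ _ _
      · right
        have hm := match_relevantAtoms hinit.2 hi
        obtain rfl := hm.eq_erase fun l' hl' =>
          subset_of_join_subset (subset_relevantAtoms hw List.nil_prefix rfl) hl'
        refine ⟨_, ⟨ht', hu, ?_⟩, (match_erase (Q := Set.univ) _).instantiates_slice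
          (Set.subset_univ _)⟩
        rw [erase_fill, erase_fill, erase_app, erase_labelAll, ctx_map_map]
        exact .builtin _ op _ t hb
  | ac _ s _ hinit hflat hunflat =>
    obtain ⟨u', hs, hm⟩ := (match_relevantAtoms hinit.2 hi).acStep hflat hunflat hu ht'
    exact .inr ⟨u', hs, hm.instantiates_slice subset_rfl⟩

end Steps

end TraceSlicing

theorem theorem2 {S F V A : Type*} [DecidableEq F] [DecidableEq V] [DecidableEq A] [Infinite A]
    (R : Theory S F V)
    (t₀ : GTm F) (T : List (StepName F V × GTm F)) (hT : R.IsTrace t₀ T)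
    (𝓛 : List (LGTm F A × LGTm F A)) (h𝓛 : R.IsTraceLabeling t₀ T 𝓛)
    (O : Set Pos) (hO : O ⊆ (lastTerm t₀ T).positions)
    (t₀' : GTm F) (ht₀' : R.IsGround t₀')
    (hc : Concretizes (slice t₀ (relevant O 𝓛)) t₀') :
    ∃ T' : List (StepName F V × GTm F), R.IsTrace t₀' T' ∧
      List.Forall₂ (fun a b => a.1 = b.1 ∧ Concretizes a.2 b.2) (traceSlice O t₀ T 𝓛) T' := by
  clear hO
  -- The concretization varies: after a simulated step the induction continues from the new term,
  -- after a discarded one from the same term, which also concretizes the next slice.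
  induction h𝓛 generalizing t₀' with
  | nil t => exact ⟨[], .nil _ ht₀', by simp [traceSlice]⟩
  | cons n t u T tL uL 𝓛 ht hu h _ ih =>
    subst ht hu
    cases hT with
    | cons _ _ _ _ hstep hT =>
      by_cases he : slice (erase tL) (relevant O ((tL, uL) :: 𝓛)) =
          slice (erase uL) (relevant O 𝓛)
      · rw [traceSlice, if_pos he]
        exact ih hT t₀' ht₀' (he ▸ hc)
      · rcases h.sound hstep.2.1 ht₀' (concretizes_iff.1 hc) with h' | ⟨u', hs, hi⟩
        · exact absurd h' he
        · have hc' : Concretizes (slice (erase uL) (relevant O 𝓛)) u' := concretizes_iff.2 hi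
          obtain ⟨T', hT', hF⟩ := ih hT u' hs.2.1 hc'
          rw [traceSlice, if_neg he]
          exact ⟨(n, u') :: T', .cons n _ u' T' hs hT', .cons ⟨rfl, hc'⟩ hF⟩
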